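/- Let $(X,d)$ be a complete separable metric space, $m\neq 0$ a non-negative Borel measure on $X$ that is finite on balls, and $p\in(1,\infty)$. Functions are considered up to $m$-a.e. equality; $L^0(m)^+$ denotes the Borel functions $X\to[0,+\infty]$, and $L^p_{loc}(m)$ the Borel functions $u:X\to\mathbb{R}$ that are $p$-integrable on every bounded Borel set (with convergence in $L^p$ on every bounded Borel set). $\mathrm{Lip}(u)$ is the optimal Lipschitz constant of a Lipschitz function $u$, and $0\cdot\infty=0$. A *$D$-structure* assigns to every $u\in L^p_{loc}(m)$ a set $D[u]\subseteq L^0(m)^+$ of pseudo-gradients such that: - (A1) $\mathrm{Lip}(u)\,\chi_{\{u>0\}}\in D[u]$ for every non-negative Lipschitz $u\in L^p_{loc}(m)$; - (A2) if $g_i\in D[u_i]$, $\alpha_i\in\mathbb{R}$ ($i=1,2$), $g\in L^0(m)^+$ and $g\ge|\alpha_1|g_1+|\alpha_2|g_2$ $m$-a.e., then $g\in D[\alpha_1u_1+\alpha_2u_2]$; - (A3) if $g\in D[u]$ and $\varphi:X\to\mathbb{R}$ is bounded and Lipschitz, then $g\sup_X|\varphi|+\mathrm{Lip}(\varphi)|u|\in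 D[\varphi u]$; - (A4) if $g_i\in D[u_i]$ ($i=1,2$), then $\max\{g_1,g_2\}\in D[\max\{u_1,u_2\}]\cap D[\min\{u_1,u_2\}]$; - (A5) if $g_n\in D[u_n]\cap L^p(m)$, $u_n\to u$ in $L^p_{loc}(m)$ and $g_n\to g$ in $L^p(m)$, then $g\in D[u]$. For a Borel set $B\subseteq X$ put $\mathcal E_p(u|B)=\inf\{\int_B g^p\,dm : g\in D[u]\}\in[0,\infty]$, and let $S^p(X)$ be the set of all $u\in L^p_{loc}(m)$ with $\mathcal E_p(u|X)<\infty$. For $u\in S^p(X)$ the *minimal pseudo-gradient* $\underline Du$ is the unique element of $D[u]$ with $\mathcal E_p(u|X)=\int_X(\underline Du)^p\,dm$. The $D$-structure is *pointwise local* if for every $u\in S^p(X)$: $\mathcal E_p(u|B)=0$ for every Borel set $B$ on which $u$ is $m$-a.e. constant, and $\underline Du\le g$ $m$-a.e. for every $g\in D[u]$. **Proposition (Calculus rules for the minimal pseudo-gradient).** For every pointwise local $D$-structure on $(X,d,m)$, the minimal pseudo-gradient of each $u\in S^p(X)$ exists and is unique up to $m$-a.e. equality, and the following hold. 1. If $u\in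 S^p(X)$ and $N\subseteq\mathbb{R}$ is a Borel set with $\mathcal L^1(N)=0$, then $\underline Du=0$ $m$-a.e. in $u^{-1}(N)$. 2. (Chain rule) Let $u\in S^p(X)$ and let $\varphi:\mathbb{R}\to\mathbb{R}$ be Lipschitz, with $\varphi'$ denoting any function on $\mathbb{R}$ that coincides $\mathcal L^1$-a.e. with the derivative of $\varphi$. Then $|\varphi'|\circ u\,\underline Du\in D[\varphi\circ u]$; more precisely, $\varphi\circ u\in S^p(X)$ and $\underline D(\varphi\circ u)=|\varphi'|\circ u\,\underline Du$ $m$-a.e. in $X$. 3. (Leibniz rule) Let $u,v\in S^p(X)\cap L^\infty(m)$. Then $|u|\,\underline Dv+|v|\,\underline Du\in D[uv]$, $uv\in S^p(X)\cap L^\infty(m)$, and $\underline D(uv)\le|u|\,\underline Dv+|v|\,\underline Du$ $m$-a.e. in $X$. -/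

import Mathlib

open MeasureTheory Filter Topology
open scoped ENNReal NNReal

/-- `u ∈ L^p_loc(m)`: `u` is (a.e. equal to) a Borel function and its restriction to every bounded
Borel set is `p`-integrable. -/
def MemLpLoc {X : Type*} [MetricSpace X] [MeasurableSpace X]
    (m : Measure X) (p : ℝ) (u : X → ℝ) : Prop :=
  AEStronglyMeasurable u m ∧
    ∀ B : Set X, MeasurableSet B → Bornology.IsBounded B →
      MemLp u (ENNReal.ofReal p) (m.restrict B)

/-- Convergence `u n → v` in `L^p_loc(m)`. -/
def TendstoLpLoc {X : Type*} [MetricSpace X] [MeasurableSpace X]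
    (m : Measure X) (p : ℝ) (u : ℕ → X → ℝ) (v : X → ℝ) : Prop :=
  ∀ B : Set X, MeasurableSet B → Bornology.IsBounded B →
    Tendsto (fun n => eLpNorm (fun x => u n x - v x) (ENNReal.ofReal p) (m.restrict B))
      atTop (𝓝 0)

/-- `g ∈ L^p(m)^+` for a `[0,∞]`-valued function `g`, considered up to a.e. equality. -/
def MemLpPos {X : Type*} [MeasurableSpace X] (m : Measure X) (p : ℝ) (g : X → ℝ≥0∞) : Prop :=
  AEMeasurable g m ∧ ∫⁻ x, g x ^ p ∂m < ∞

/-- The optimal Lipschitz constant `Lip(u)` (to be used for Lipschitz functions only). -/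
noncomputable def lipConst {X : Type*} [MetricSpace X] (u : X → ℝ) : ℝ≥0 :=
  sInf {K : ℝ≥0 | LipschitzWith K u}

/-- A `D`-structure on `(X, d, m)` with exponent `p`. It associates to every `u ∈ L^p_loc(m)` a set
of pseudo-gradients, i.e. of `[0,∞]`-valued measurable functions. Both `u` and its pseudo-gradients
are given by representatives, and by `congr_ae` everything depends on the `m`-a.e. equivalence
classes only. The values of `pseudoGrad` outside `L^p_loc(m)` play no role. -/
structure DStructure {X : Type*} [MetricSpace X] [MeasurableSpace X]
    (m : Measure X) (p : ℝ) where
  /-- The set `D[u]` of pseudo-gradients of `u`. -/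
  pseudoGrad : (X → ℝ) → Set (X → ℝ≥0∞)
  aemeasurable : ∀ (u : X → ℝ) (g : X → ℝ≥0∞), MemLpLoc m p u → g ∈ pseudoGrad u →
    AEMeasurable g m
  congr_ae : ∀ (u v : X → ℝ) (g h : X → ℝ≥0∞), MemLpLoc m p u → u =ᵐ[m] v → g =ᵐ[m] h →
    g ∈ pseudoGrad u → h ∈ pseudoGrad v
  /-- Non triviality: `Lip(u) χ_{u > 0} ∈ D[u]` for nonnegative Lipschitz `u`. -/
  nontriviality : ∀ u : X → ℝ, MemLpLoc m p u → (∀ x, 0 ≤ u x) → (∃ K, LipschitzWith K u) →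
    Set.indicator {x | 0 < u x} (fun _ => (lipConst u : ℝ≥0∞)) ∈ pseudoGrad u
  /-- Upper linearity. -/
  upper_linearity : ∀ (u₁ u₂ : X → ℝ) (g₁ g₂ g : X → ℝ≥0∞) (α₁ α₂ : ℝ),
    MemLpLoc m p u₁ → MemLpLoc m p u₂ → g₁ ∈ pseudoGrad u₁ → g₂ ∈ pseudoGrad u₂ →
    AEMeasurable g m → (∀ᵐ x ∂m, ‖α₁‖ₑ * g₁ x + ‖α₂‖ₑ * g₂ x ≤ g x) →
    g ∈ pseudoGrad (fun x => α₁ * u₁ x + α₂ * u₂ x)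
  /-- Leibniz rule: `g sup |φ| + Lip(φ) |u| ∈ D[φ u]` for bounded Lipschitz `φ`. -/
  leibniz : ∀ (u : X → ℝ) (g : X → ℝ≥0∞) (φ : X → ℝ),
    MemLpLoc m p u → g ∈ pseudoGrad u → (∃ K, LipschitzWith K φ) → (∃ C, ∀ x, |φ x| ≤ C) →
    (fun x => g x * (⨆ y, ‖φ y‖ₑ) + (lipConst φ : ℝ≥0∞) * ‖u x‖ₑ) ∈
      pseudoGrad (fun x => φ x * u x)
  /-- Lattice property. -/
  lattice : ∀ (u₁ u₂ : X → ℝ) (g₁ g₂ : X → ℝ≥0∞),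
    MemLpLoc m p u₁ → MemLpLoc m p u₂ → g₁ ∈ pseudoGrad u₁ → g₂ ∈ pseudoGrad u₂ →
    (fun x => max (g₁ x) (g₂ x)) ∈ pseudoGrad (fun x => max (u₁ x) (u₂ x)) ∧
    (fun x => max (g₁ x) (g₂ x)) ∈ pseudoGrad (fun x => min (u₁ x) (u₂ x))
  /-- Completeness. The functions `g n`, `g₀` are in `L^p(m)`, hence finite a.e., so that `toReal`
  only serves to form the difference. -/
  completeness : ∀ (u : ℕ → X → ℝ) (g : ℕ → X → ℝ≥0∞) (u₀ : X → ℝ) (g₀ : X → ℝ≥0∞),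
    (∀ n, MemLpLoc m p (u n)) → (∀ n, MemLpPos m p (g n)) → (∀ n, g n ∈ pseudoGrad (u n)) →
    MemLpLoc m p u₀ → MemLpPos m p g₀ → TendstoLpLoc m p u u₀ →
    Tendsto (fun n => eLpNorm (fun x => (g n x).toReal - (g₀ x).toReal) (ENNReal.ofReal p) m)
      atTop (𝓝 0) →
    g₀ ∈ pseudoGrad u₀

namespace DStructure

/-- The `p`-Dirichlet energy of `u` on `B` (it is `∞` if `u` has no pseudo-gradients). -/
noncomputable def energy {X : Type*} [MetricSpace X] [MeasurableSpace X]
    {m : Measure X} {p : ℝ} (D : DStructure m p) (u : X → ℝ) (B : Set X) : ℝ≥0∞ :=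
  ⨅ g ∈ D.pseudoGrad u, ∫⁻ x in B, g x ^ p ∂m

/-- Membership in the Sobolev class `S^p(X, d, m, D)`. -/
def MemSobolev {X : Type*} [MetricSpace X] [MeasurableSpace X]
    {m : Measure X} {p : ℝ} (D : DStructure m p) (u : X → ℝ) : Prop :=
  MemLpLoc m p u ∧ D.energy u Set.univ < ∞

/-- `g` is a pseudo-gradient of `u` that attains the energy of `u`. -/
def IsMinimal {X : Type*} [MetricSpace X] [MeasurableSpace X]
    {m : Measure X} {p : ℝ} (D : DStructure m p) (u : X → ℝ) (g : X → ℝ≥0∞) : Prop :=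
  g ∈ D.pseudoGrad u ∧ D.energy u Set.univ = ∫⁻ x, g x ^ p ∂m

/-- The minimal pseudo-gradient of `u ∈ S^p(X)`: a representative of the a.e. class of the
pseudo-gradients attaining the energy of `u`. -/
noncomputable def minGrad {X : Type*} [MetricSpace X] [MeasurableSpace X]
    {m : Measure X} {p : ℝ} (D : DStructure m p) (u : X → ℝ) : X → ℝ≥0∞ :=
  Classical.epsilon (D.IsMinimal u)

/-- If `u ∈ S^p(X)` is a.e. constant on a Borel set `B`, then its energy on `B` vanishes. -/
def EnergyLocal {X : Type*} [MetricSpace X] [MeasurableSpace X]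
    {m : Measure X} {p : ℝ} (D : DStructure m p) : Prop :=
  ∀ (B : Set X) (u : X → ℝ), MeasurableSet B → D.MemSobolev u →
    (∃ c : ℝ, ∀ᵐ x ∂m, x ∈ B → u x = c) → D.energy u B = 0

/-- The minimal pseudo-gradient of `u ∈ S^p(X)` is a.e. below every pseudo-gradient of `u`. -/
def MinGradLe {X : Type*} [MetricSpace X] [MeasurableSpace X]
    {m : Measure X} {p : ℝ} (D : DStructure m p) : Prop :=
  ∀ (u : X → ℝ) (g : X → ℝ≥0∞), D.MemSobolev u → g ∈ D.pseudoGrad u → D.minGrad u ≤ᵐ[m] g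

/-- Pointwise local `D`-structures. -/
def PointwiseLocal {X : Type*} [MetricSpace X] [MeasurableSpace X]
    {m : Measure X} {p : ℝ} (D : DStructure m p) : Prop :=
  D.EnergyLocal ∧ D.MinGradLe

end DStructure

/-! Existence of the minimal pseudo-gradient is the direct method: `D[u]` is convex and closed in
`L^p`, and quantitative strict convexity of `t ↦ t ^ p` makes minimizing sequences Cauchy
(`exists_isMinimal`). Uniqueness follows from pointwise minimality.

The chain rule starts from the crude bound `D(φ ∘ u) ≤ L Du` for `L`-Lipschitz `φ`: such a `φ` is an
infimum of countably many cones, so the lattice and completeness axioms apply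
(`lipschitz_comp_mem`). Locality shows that minimal pseudo-gradients agree where the functions do,
so the bound localizes to open sets on whose intervals `φ` is `c`-Lipschitz. For a Borel set `A`
with `|φ'| ≤ c` on it, `φ` is approximated by functions whose derivative is cut to zero on a small
neighbourhood minus `A`, and completeness passes to the limit. Letting `c` run through the rationals
gives `D(φ ∘ u) ≤ |ψ| ∘ u · Du` for every Borel version `ψ` of `φ'` (`minGrad_comp_le`). Taking `φ =
id` and `ψ = 1` off a null set `N` gives the vanishing on `u⁻¹(N)`. The reverse inequality comes
from applying the upper bound to `L t - φ(t)` where `φ' ≥ 0`, and from replacing `φ` by `-φ`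
elsewhere.

For the Leibniz rule, polarization `4uv = (ru + v/r)² - (ru - v/r)²` and the chain rule for squares
give `D(uv) ≤ max(r|u|, |v|/r) (r Du + Dv/r)` for each `r > 0`. Optimizing `r` pointwise, with `r² =
|v|/|u|`, yields `|u| Dv + |v| Du`. -/

/-! ### Local `L^p` spaces and Lipschitz postcomposition. -/

section LpLoc

variable {X : Type*} [MetricSpace X] [MeasurableSpace X] {m : Measure X} {p : ℝ}

lemma MemLpLoc.congr {u v : X → ℝ} (hu : MemLpLoc m p u) (h : u =ᵐ[m] v) : MemLpLoc m p v :=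
  ⟨hu.1.congr h, fun B hB hb => (hu.2 B hB hb).ae_eq (ae_restrict_of_ae h)⟩

lemma MemLpLoc.add {u v : X → ℝ} (hu : MemLpLoc m p u) (hv : MemLpLoc m p v) :
    MemLpLoc m p (fun x => u x + v x) :=
  ⟨hu.1.add hv.1, fun B hB hb => (hu.2 B hB hb).add (hv.2 B hB hb)⟩

lemma MemLpLoc.const_mul {u : X → ℝ} (hu : MemLpLoc m p u) (c : ℝ) :
    MemLpLoc m p (fun x => c * u x) :=
  ⟨hu.1.const_mul c, fun B hB hb => (hu.2 B hB hb).const_mul c⟩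

lemma measure_lt_top_of_isBounded (hball : ∀ (x : X) (r : ℝ), m (Metric.ball x r) < ∞)
    {B : Set X} (hB : Bornology.IsBounded B) : m B < ∞ := by
  rcases B.eq_empty_or_nonempty with rfl | ⟨x, -⟩
  · simp
  · obtain ⟨r, hr⟩ := hB.subset_ball x
    exact (measure_mono hr).trans_lt (hball x r)

lemma memLpLoc_const (hball : ∀ (x : X) (r : ℝ), m (Metric.ball x r) < ∞) (c : ℝ) :
    MemLpLoc m p (fun _ => c) := by
  refine ⟨aestronglyMeasurable_const, fun B _ hb => ?_⟩
  have : IsFiniteMeasure (m.restrict B) :=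
    ⟨by simpa using measure_lt_top_of_isBounded hball hb⟩
  exact memLp_const c

lemma MemLpLoc.lipschitz_comp (hball : ∀ (x : X) (r : ℝ), m (Metric.ball x r) < ∞)
    {u : X → ℝ} (hu : MemLpLoc m p u) {L : ℝ≥0} {φ : ℝ → ℝ} (hφ : LipschitzWith L φ) :
    MemLpLoc m p (φ ∘ u) := by
  refine ⟨hφ.continuous.comp_aestronglyMeasurable hu.1, fun B hB hb => ?_⟩
  have : IsFiniteMeasure (m.restrict B) :=
    ⟨by simpa using measure_lt_top_of_isBounded hball hb⟩
  -- `comp_memLp` needs a map vanishing at `0`; the constant `φ 0` is restored afterwards, being in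
  -- `L^p` of a set of finite measure.
  have h1 : LipschitzWith L (fun t => φ t - φ 0) := by
    simpa using hφ.sub (LipschitzWith.const (φ 0))
  have h2 := (h1.comp_memLp (by simp) (hu.2 B hB hb)).add (memLp_const (φ 0))
  refine h2.ae_eq (ae_of_all _ fun x => ?_)
  simp

/-- Postcompositions with equi-Lipschitz pointwise convergent functions converge in `L^p_loc`. -/
lemma tendstoLpLoc_lipschitz_comp (hball : ∀ (x : X) (r : ℝ), m (Metric.ball x r) < ∞)
    (hp : 1 < p) {u : X → ℝ} (hu : MemLpLoc m p u) {L : ℝ≥0} {φs : ℕ → ℝ → ℝ} {φ : ℝ → ℝ}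
    (hφs : ∀ n, LipschitzWith L (φs n)) (hφ : LipschitzWith L φ)
    (hlim : ∀ t, Tendsto (fun n => φs n t) atTop (𝓝 (φ t))) :
    TendstoLpLoc m p (fun n => φs n ∘ u) (φ ∘ u) := by
  intro B hB hb
  have hp0 : 0 < p := by linarith
  have : IsFiniteMeasure (m.restrict B) :=
    ⟨by simpa using measure_lt_top_of_isBounded hball hb⟩
  obtain ⟨C, hC⟩ : ∃ C, ∀ n, |φs n 0 - φ 0| ≤ C := by
    obtain ⟨C, hC⟩ := ((hlim 0).sub_const (φ 0)).norm.bddAbove_range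
    exact ⟨C, fun n => hC ⟨n, rfl⟩⟩
  -- Dominating function: the difference is at most `C` at `0`, and both functions are
  -- `L`-Lipschitz.
  set w : X → ℝ := fun x => C + 2 * L * |u x| with hw
  have hwL : MemLp w (ENNReal.ofReal p) (m.restrict B) :=
    (memLp_const C).add ((hu.2 B hB hb).norm.const_mul (2 * L : ℝ))
  have hbd : ∀ n x, |φs n (u x) - φ (u x)| ≤ w x := by
    intro n x
    have h1 := (hφs n).dist_le_mul (u x) 0
    have h2 := hφ.dist_le_mul (u x) 0
    simp only [Real.dist_eq, sub_zero] at h1 h2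
    have h3 := hC n
    rw [abs_le] at h1 h2 h3 ⊢
    simp only [hw]
    constructor <;> linarith
  have hne0 : ENNReal.ofReal p ≠ 0 := by simpa using hp0
  have htr : (ENNReal.ofReal p).toReal = p := ENNReal.toReal_ofReal hp0.le
  have key : Tendsto (fun n => ∫⁻ x in B, ‖φs n (u x) - φ (u x)‖ₑ ^ p ∂m) atTop (𝓝 0) := by
    have := tendsto_lintegral_of_dominated_convergence' (μ := m.restrict B)
      (F := fun n x => ‖φs n (u x) - φ (u x)‖ₑ ^ p) (f := fun _ => 0)
      (fun x => ‖w x‖ₑ ^ p) ?_ ?_ ?_ ?_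
    · simpa using this
    · intro n
      exact ((((hφs n).continuous.comp_aestronglyMeasurable hu.1).sub
        (hφ.continuous.comp_aestronglyMeasurable hu.1)).enorm.restrict).pow_const p
    · intro n
      refine ae_of_all _ fun x => ?_
      refine ENNReal.rpow_le_rpow ?_ hp0.le
      rw [enorm_le_iff_norm_le]
      exact (hbd n x).trans (le_abs_self _)
    · have := (eLpNorm_lt_top_iff_lintegral_rpow_enorm_lt_top hne0 ENNReal.ofReal_ne_top).1 hwL.2
      rw [htr] at this
      exact this.ne
    · refine ae_of_all _ fun x => ?_
      have h1 : Tendsto (fun n => ‖φs n (u x) - φ (u x)‖ₑ) atTop (𝓝 0) := by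
        have := ((hlim (u x)).sub_const (φ (u x))).enorm
        simpa using this
      have := (ENNReal.continuous_rpow_const (y := p)).tendsto 0 |>.comp h1
      rw [ENNReal.zero_rpow_of_pos hp0] at this
      exact this
  have h2 := (ENNReal.continuous_rpow_const (y := 1 / p)).tendsto 0 |>.comp key
  rw [ENNReal.zero_rpow_of_pos (by positivity)] at h2
  refine h2.congr fun n => ?_
  rw [eLpNorm_eq_lintegral_rpow_enorm_toReal hne0 ENNReal.ofReal_ne_top, htr]
  rfl

end LpLoc

/-! ### Direct consequences of the axioms and the crude Lipschitz bound. -/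

namespace DStructure

section Basic

variable {X : Type*} [MetricSpace X] [MeasurableSpace X] {m : Measure X} {p : ℝ}
  (D : DStructure m p)

lemma mem_of_le {u : X → ℝ} {g h : X → ℝ≥0∞} (hu : MemLpLoc m p u) (hg : g ∈ D.pseudoGrad u)
    (hh : AEMeasurable h m) (hgh : g ≤ᵐ[m] h) : h ∈ D.pseudoGrad u := by
  have h1 := D.upper_linearity u u g g h 1 0 hu hu hg hg hh
    (hgh.mono fun x hx => by simpa using hx)
  have e : (fun x => (1 : ℝ) * u x + 0 * u x) = u := by funext x; ring
  rwa [e] at h1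

lemma add_mem {u v : X → ℝ} {g h : X → ℝ≥0∞} (hu : MemLpLoc m p u) (hv : MemLpLoc m p v)
    (hg : g ∈ D.pseudoGrad u) (hh : h ∈ D.pseudoGrad v) :
    (fun x => g x + h x) ∈ D.pseudoGrad (fun x => u x + v x) := by
  have h1 := D.upper_linearity u v g h (fun x => g x + h x) 1 1 hu hv hg hh
    ((D.aemeasurable u g hu hg).add (D.aemeasurable v h hv hh)) (by simp)
  have e : (fun x => (1 : ℝ) * u x + 1 * v x) = fun x => u x + v x := by funext x; ring
  rwa [e] at h1

lemma const_mul_mem {u : X → ℝ} {g : X → ℝ≥0∞} (hu : MemLpLoc m p u)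
    (hg : g ∈ D.pseudoGrad u) (c : ℝ) :
    (fun x => ‖c‖ₑ * g x) ∈ D.pseudoGrad (fun x => c * u x) := by
  have h1 := D.upper_linearity u u g g (fun x => ‖c‖ₑ * g x) c 0 hu hu hg hg
    ((D.aemeasurable u g hu hg).const_mul _) (by simp)
  have e : (fun x => c * u x + 0 * u x) = fun x => c * u x := by funext x; ring
  rwa [e] at h1

/-- (A1) covers the constant `|c|`, whose optimal Lipschitz constant is zero; upper linearity
restores the sign. -/
lemma zero_mem_const (hball : ∀ (x : X) (r : ℝ), m (Metric.ball x r) < ∞) (c : ℝ) :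
    (fun _ => 0) ∈ D.pseudoGrad (fun _ => c) := by
  have hl : lipConst (fun _ : X => |c|) = 0 := by
    refine le_antisymm ?_ zero_le
    exact csInf_le (OrderBot.bddBelow _) (LipschitzWith.const |c|)
  have h1 := D.nontriviality (fun _ => |c|) (memLpLoc_const hball _) (fun _ => abs_nonneg c)
    ⟨0, LipschitzWith.const _⟩
  rw [hl] at h1
  have e1 : Set.indicator {_x : X | 0 < |c|} (fun _ => ((0 : ℝ≥0) : ℝ≥0∞)) = fun _ => 0 := by
    funext x; simp
  rw [e1] at h1
  rcases abs_choice c with h | h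
  · rwa [h] at h1
  · have h2 := D.const_mul_mem (memLpLoc_const hball _) h1 (-1)
    simpa [h] using h2

lemma add_const_mem (hball : ∀ (x : X) (r : ℝ), m (Metric.ball x r) < ∞)
    {u : X → ℝ} {g : X → ℝ≥0∞} (hu : MemLpLoc m p u)
    (hg : g ∈ D.pseudoGrad u) (c : ℝ) : g ∈ D.pseudoGrad (fun x => u x + c) := by
  simpa using D.add_mem hu (memLpLoc_const hball c) hg (D.zero_mem_const hball c)

/-- A pseudo-gradient of finite energy common to the postcompositions of `u` with equi-Lipschitz
functions is inherited by pointwise limits. -/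
lemma mem_comp_of_tendsto (hball : ∀ (x : X) (r : ℝ), m (Metric.ball x r) < ∞) (hp : 1 < p)
    {u : X → ℝ} (hu : MemLpLoc m p u) {L : ℝ≥0} {φs : ℕ → ℝ → ℝ} {φ : ℝ → ℝ}
    (hφs : ∀ n, LipschitzWith L (φs n)) (hφ : LipschitzWith L φ)
    (hlim : ∀ t, Tendsto (fun n => φs n t) atTop (𝓝 (φ t)))
    {g : X → ℝ≥0∞} (hg : ∀ n, g ∈ D.pseudoGrad (φs n ∘ u)) (hgp : ∫⁻ x, g x ^ p ∂m < ∞) :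
    g ∈ D.pseudoGrad (φ ∘ u) := by
  have hgm : MemLpPos m p g :=
    ⟨D.aemeasurable _ g (hu.lipschitz_comp hball (hφs 0)) (hg 0), hgp⟩
  refine D.completeness (fun n => φs n ∘ u) (fun _ => g) _ g
    (fun n => hu.lipschitz_comp hball (hφs n)) (fun _ => hgm) hg (hu.lipschitz_comp hball hφ) hgm
    (tendstoLpLoc_lipschitz_comp hball hp hu hφs hφ hlim) ?_
  simp

/-- Postcomposition with an `L`-Lipschitz function multiplies pseudo-gradients at most by `L`. -/
lemma lipschitz_comp_mem (hball : ∀ (x : X) (r : ℝ), m (Metric.ball x r) < ∞) (hp : 1 < p)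
    {u : X → ℝ} (hu : MemLpLoc m p u) {g : X → ℝ≥0∞} (hg : g ∈ D.pseudoGrad u)
    (hgp : ∫⁻ x, g x ^ p ∂m < ∞) {L : ℝ≥0} {φ : ℝ → ℝ} (hφ : LipschitzWith L φ) :
    (fun x => (L : ℝ≥0∞) * g x) ∈ D.pseudoGrad (φ ∘ u) := by
  have hp0 : 0 < p := by linarith
  set q : ℕ → ℝ := TopologicalSpace.denseSeq ℝ with hq
  -- `φ` is the infimum of these cones with vertices over a dense set. Each cone is handled by `|s|
  -- = max s (-s)` and the lattice property.
  set c : ℕ → ℝ → ℝ := fun i t => φ (q i) + L * |t - q i| with hc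
  have hcL : ∀ i, LipschitzWith L (c i) := by
    intro i
    refine LipschitzWith.of_dist_le_mul fun x y => ?_
    have h1 : |x - q i| - |y - q i| ≤ |x - y| := by
      have := abs_sub_abs_le_abs_sub (x - q i) (y - q i); simpa using this
    have h2 : |y - q i| - |x - q i| ≤ |x - y| := by
      have := abs_sub_abs_le_abs_sub (y - q i) (x - q i)
      rw [abs_sub_comm x y]; simpa using this
    have hL := L.coe_nonneg
    simp only [hc, Real.dist_eq]
    rw [abs_le]
    constructor <;> nlinarith
  have hle : ∀ i t, φ t ≤ c i t := by
    intro i t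
    have := hφ.dist_le_mul t (q i)
    rw [Real.dist_eq, Real.dist_eq, abs_le] at this
    simp only [hc]; linarith [this.2]
  have hcm : ∀ i, (fun x => (L : ℝ≥0∞) * g x) ∈ D.pseudoGrad (c i ∘ u) := by
    intro i
    have hv := hu.add (memLpLoc_const hball (-q i))
    have hvg := D.add_const_mem hball hu hg (-q i)
    have h1 := (D.lattice _ _ _ _ (hv.const_mul L) (hv.const_mul (-(L : ℝ)))
      (D.const_mul_mem hv hvg L) (D.const_mul_mem hv hvg (-(L : ℝ)))).1
    have hm1 : MemLpLoc m p
        (fun x => max ((L : ℝ) * (u x + -q i)) (-(L : ℝ) * (u x + -q i))) := by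
      have : LipschitzWith L (fun t : ℝ => L * |t - q i|) := by
        simpa [hc] using (hcL i).sub (LipschitzWith.const (φ (q i)))
      refine (hu.lipschitz_comp hball this).congr (ae_of_all _ fun x => ?_)
      simp only [Function.comp]
      rw [← abs_of_nonneg L.coe_nonneg, ← abs_mul, abs_of_nonneg L.coe_nonneg,
        abs_eq_max_neg, neg_mul, sub_eq_add_neg]
    have h2 := D.add_const_mem hball hm1 h1 (φ (q i))
    refine D.congr_ae _ _ _ _ (hm1.add (memLpLoc_const hball _)) (ae_of_all _ fun x => ?_)
      (ae_of_all _ fun x => ?_) h2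
    · simp only [hc, Function.comp]
      rw [neg_mul, ← abs_eq_max_neg, abs_mul, abs_of_nonneg L.coe_nonneg, sub_eq_add_neg]
      ring
    · simp [Real.enorm_eq_ofReal_abs]
  -- The minimum of the first `n + 1` cones: it keeps both the Lipschitz constant and the
  -- pseudo-gradient, and decreases to `φ`.
  let F : ℕ → ℝ → ℝ := fun n => Nat.rec (c 0) (fun k f t => min (f t) (c (k + 1) t)) n
  have hFs : ∀ n, F (n + 1) = fun t => min (F n t) (c (n + 1) t) := fun n => rfl
  have hFL : ∀ n, LipschitzWith L (F n) := by
    intro n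
    induction n with
    | zero => exact hcL 0
    | succ k ih => rw [hFs]; simpa using ih.min (hcL (k + 1))
  have hFm : ∀ n, (fun x => (L : ℝ≥0∞) * g x) ∈ D.pseudoGrad (F n ∘ u) := by
    intro n
    induction n with
    | zero => exact hcm 0
    | succ k ih =>
      have := (D.lattice _ _ _ _ (hu.lipschitz_comp hball (hFL k))
        (hu.lipschitz_comp hball (hcL (k + 1))) ih (hcm (k + 1))).2
      simp only [max_self] at this
      exact this
  have hFle : ∀ n t, φ t ≤ F n t := by
    intro n t
    induction n with
    | zero => exact hle 0 t
    | succ k ih => rw [hFs]; exact le_min ih (hle _ t)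
  have hFanti : ∀ t, Antitone fun n => F n t := fun t =>
    antitone_nat_of_succ_le fun n => by simp only [hFs]; exact min_le_left _ _
  have hFc : ∀ n t, F n t ≤ c n t := by
    intro n t
    cases n with
    | zero => exact le_rfl
    | succ k => rw [hFs]; exact min_le_right _ _
  refine D.mem_comp_of_tendsto hball hp hu hFL hφ (fun t => ?_) hFm ?_
  · rw [Metric.tendsto_atTop]
    intro ε hε
    -- A cone exceeds `φ` at `t` by at most `2 L |t - q i|`; the added `1` covers the case `L = 0`.
    obtain ⟨i, hi⟩ := (TopologicalSpace.denseRange_denseSeq ℝ).exists_dist_lt t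
      (show 0 < ε / (2 * L + 1) by positivity)
    refine ⟨i, fun n hn => ?_⟩
    have h1 := (hFanti t hn).trans (hFc i t)
    have h2 := hFle n t
    have h3 := hφ.dist_le_mul (q i) t
    rw [Real.dist_eq, abs_of_nonneg (by linarith)]
    rw [dist_comm (q i) t, Real.dist_eq, Real.dist_eq, abs_le] at h3
    rw [Real.dist_eq, lt_div_iff₀ (by positivity)] at hi
    simp only [hc, hq] at h1 h3
    have := abs_nonneg (t - TopologicalSpace.denseSeq ℝ i)
    nlinarith [h3.2, L.coe_nonneg]
  · simp_rw [ENNReal.mul_rpow_of_nonneg _ _ hp0.le]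
    have hL : (L : ℝ≥0∞) ^ p ≠ ∞ := ENNReal.rpow_ne_top_of_nonneg hp0.le ENNReal.coe_ne_top
    rw [lintegral_const_mul' _ _ hL]
    exact ENNReal.mul_lt_top hL.lt_top hgp

end Basic

end DStructure

/-! ### Quantitative strict convexity of the `p`-th power. -/

section UniformConvexity

/-- Quantitative strict convexity of `t ↦ t ^ p`, in homogeneous form. -/
lemma exists_abs_sub_rpow_add_le {p : ℝ} (hp : 1 < p) {ε : ℝ} (hε : 0 < ε) :
    ∃ C : ℝ, 0 ≤ C ∧ ∀ a b : ℝ, 0 ≤ a → 0 ≤ b →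
      |a - b| ^ p + 2 * C * ((a + b) / 2) ^ p ≤ (ε + C) * (a ^ p + b ^ p) := by
  have hp0 : 0 < p := by linarith
  -- By homogeneity one may take `a + b = 1` and `a = t`. The convexity gap `F` below vanishes only
  -- at `t = 1 / 2`.
  set N : ℝ → ℝ := fun t => t ^ p + (1 - t) ^ p with hN
  have hNc : Continuous N :=
    (Real.continuous_rpow_const hp0.le).add
      ((Real.continuous_rpow_const hp0.le).comp (continuous_const.sub continuous_id))
  set F : ℝ → ℝ := fun t => N t - 2 * (1 / 2 : ℝ) ^ p with hF
  have hFc : Continuous F := hNc.sub continuous_const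
  have hFpos : ∀ t ∈ Set.Icc (0 : ℝ) 1, t ≠ 1 / 2 → 0 < F t := by
    intro t ht hne
    have := (strictConvexOn_rpow hp).2 (x := t) (y := 1 - t) ht.1
      (show (0 : ℝ) ≤ 1 - t by linarith [ht.2]) (fun h => hne (by linarith))
      (show (0 : ℝ) < 1 / 2 by norm_num) (show (0 : ℝ) < 1 / 2 by norm_num) (by norm_num)
    simp only [smul_eq_mul] at this
    rw [show (1 / 2 : ℝ) * t + 1 / 2 * (1 - t) = 1 / 2 by ring] at this
    simp only [hF, hN]
    linarith
  have hF0 : ∀ t ∈ Set.Icc (0 : ℝ) 1, 0 ≤ F t := by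
    intro t ht
    by_cases h : t = 1 / 2
    · subst h
      simp only [hF, hN]
      rw [show (1 : ℝ) - 1 / 2 = 1 / 2 by norm_num]
      linarith
    · exact (hFpos t ht h).le
  have hNpos : ∀ t ∈ Set.Icc (0 : ℝ) 1, 0 ≤ N t := fun t ht =>
    add_nonneg (Real.rpow_nonneg ht.1 _) (Real.rpow_nonneg (by linarith [ht.2]) _)
  have key : ∃ C : ℝ, 0 ≤ C ∧ ∀ t ∈ Set.Icc (0 : ℝ) 1,
      |2 * t - 1| ^ p ≤ ε * N t + C * F t := by
    -- Off `S` the term `ε * N t` suffices. The compact set `S` avoids `1 / 2`, so `F` has a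
    -- positive minimum there, and its inverse serves as `C` because `|2 * t - 1| ^ p ≤ 1`.
    set S : Set ℝ := Set.Icc (0 : ℝ) 1 ∩ {t | ε * N t ≤ |2 * t - 1| ^ p} with hS
    have hAc : Continuous fun t : ℝ => |2 * t - 1| ^ p :=
      (Real.continuous_rpow_const hp0.le).comp (by fun_prop)
    have hSc : IsCompact S :=
      isCompact_Icc.inter_right (isClosed_le (continuous_const.mul hNc) hAc)
    rcases S.eq_empty_or_nonempty with hSe | hSn
    · refine ⟨0, le_rfl, fun t ht => ?_⟩
      by_contra hcon
      have : t ∈ S := ⟨ht, by simp only [Set.mem_ofPred_eq]; linarith⟩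
      simp [hSe] at this
    · obtain ⟨t₀, ht₀, hmin⟩ := hSc.exists_isMinOn hSn hFc.continuousOn
      have hne : t₀ ≠ 1 / 2 := by
        rintro rfl
        have h1 := ht₀.2
        simp only [Set.mem_ofPred_eq, hN] at h1
        rw [show (2 : ℝ) * (1 / 2) - 1 = 0 by norm_num, abs_zero, Real.zero_rpow hp0.ne'] at h1
        have : (0 : ℝ) < (1 / 2 : ℝ) ^ p := by positivity
        rw [show (1 : ℝ) - 1 / 2 = 1 / 2 by norm_num] at h1
        nlinarith
      have hδ := hFpos t₀ ht₀.1 hne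
      refine ⟨1 / F t₀, by positivity, fun t ht => ?_⟩
      by_cases h : t ∈ S
      · have h1 : F t₀ ≤ F t := hmin h
        have h2 : 1 ≤ 1 / F t₀ * F t := by
          rw [one_div, ← div_eq_inv_mul, le_div_iff₀ hδ]; linarith
        have h3 : |2 * t - 1| ^ p ≤ 1 := by
          refine Real.rpow_le_one (abs_nonneg _) ?_ hp0.le
          rw [abs_le]; constructor <;> linarith [ht.1, ht.2]
        have := hNpos t ht
        nlinarith
      · have h1 : |2 * t - 1| ^ p < ε * N t := by
          by_contra hcon
          exact h ⟨ht, not_lt.1 hcon⟩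
        have := mul_nonneg (show 0 ≤ 1 / F t₀ by positivity) (hF0 t ht)
        linarith
  obtain ⟨C, hC0, hC⟩ := key
  refine ⟨C, hC0, fun a b ha hb => ?_⟩
  rcases (add_nonneg ha hb).eq_or_lt with h0 | hs
  · have ha0 : a = 0 := by linarith
    have hb0 : b = 0 := by linarith
    subst ha0 hb0
    simp [Real.zero_rpow hp0.ne']
  · set s := a + b with hsdef
    have ht : a / s ∈ Set.Icc (0 : ℝ) 1 :=
      ⟨by positivity, by rw [div_le_one hs]; linarith⟩
    have h1 := hC _ ht
    have hsp : 0 < s ^ p := Real.rpow_pos_of_pos hs p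
    have e1 : a ^ p = s ^ p * (a / s) ^ p := by
      rw [← Real.mul_rpow hs.le ht.1]; congr 1; field_simp
    have e2 : b ^ p = s ^ p * (1 - a / s) ^ p := by
      rw [← Real.mul_rpow hs.le (by linarith [ht.2])]; congr 1; field_simp; linarith
    have e3 : |a - b| ^ p = s ^ p * |2 * (a / s) - 1| ^ p := by
      rw [← Real.mul_rpow hs.le (abs_nonneg _)]; congr 1
      rw [← abs_of_pos hs, ← abs_mul, abs_of_pos hs]; congr 1; field_simp; linarith
    have e4 : (s / 2) ^ p = s ^ p * (1 / 2 : ℝ) ^ p := by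
      rw [← Real.mul_rpow hs.le (by norm_num)]; congr 1; ring
    rw [e1, e2, e3, e4]
    simp only [hF, hN] at h1
    nlinarith [mul_le_mul_of_nonneg_left h1 hsp.le]

lemma exists_enorm_sub_rpow_add_le {p : ℝ} (hp : 1 < p) {ε : ℝ≥0} (hε : 0 < ε) :
    ∃ C : ℝ≥0, ∀ a b : ℝ≥0∞, a ≠ ∞ → b ≠ ∞ →
      ‖a.toReal - b.toReal‖ₑ ^ p + 2 * C * (2⁻¹ * a + 2⁻¹ * b) ^ p ≤
        (ε + C) * (a ^ p + b ^ p) := by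
  have hp0 : 0 < p := by linarith
  obtain ⟨C, hC0, hC⟩ := exists_abs_sub_rpow_add_le hp (NNReal.coe_pos.2 hε)
  lift C to ℝ≥0 using hC0
  refine ⟨C, fun a b ha hb => ?_⟩
  lift a to ℝ≥0 using ha
  lift b to ℝ≥0 using hb
  have h := hC a b a.2 b.2
  have h1 : ‖(a : ℝ) - (b : ℝ)‖₊ ^ p + 2 * C * (2⁻¹ * a + 2⁻¹ * b) ^ p ≤
      (ε + C) * (a ^ p + b ^ p) := by
    rw [← NNReal.coe_le_coe]
    push_cast
    rw [Real.norm_eq_abs]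
    convert h using 3
    congr 1
    ring
  have h2 : ((‖(a : ℝ) - (b : ℝ)‖₊ ^ p + 2 * C * (2⁻¹ * a + 2⁻¹ * b) ^ p : ℝ≥0) : ℝ≥0∞) ≤
      (((ε + C) * (a ^ p + b ^ p) : ℝ≥0) : ℝ≥0∞) := ENNReal.coe_le_coe.2 h1
  push_cast [ENNReal.coe_rpow_of_nonneg _ hp0.le] at h2
  exact h2

end UniformConvexity

/-! ### Existence and uniqueness of the minimal pseudo-gradient. -/

lemma ae_ne_top_of_lintegral_rpow {X : Type*} [MeasurableSpace X] {m : Measure X} {p : ℝ}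
    {g : X → ℝ≥0∞}
    (hp : 1 < p) (hg : AEMeasurable g m)
    (hgp : ∫⁻ x, g x ^ p ∂m < ∞) : ∀ᵐ x ∂m, g x ≠ ∞ := by
  filter_upwards [ae_lt_top' (hg.pow_const p) hgp.ne] with x hx h
  rw [h, ENNReal.top_rpow_of_pos (by linarith)] at hx
  exact lt_irrefl _ hx

namespace DStructure

section Minimal

variable {X : Type*} [MetricSpace X] [MeasurableSpace X] {m : Measure X} {p : ℝ}
  (D : DStructure m p)

lemma energy_le {u : X → ℝ} {g : X → ℝ≥0∞} (hg : g ∈ D.pseudoGrad u) :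
    D.energy u Set.univ ≤ ∫⁻ x, g x ^ p ∂m := by
  have := iInf₂_le (f := fun (g : X → ℝ≥0∞) (_ : g ∈ D.pseudoGrad u) =>
    ∫⁻ x in Set.univ, g x ^ p ∂m) g hg
  simpa [energy] using this

lemma memSobolev_of_mem {u : X → ℝ} (hu : MemLpLoc m p u) {g : X → ℝ≥0∞}
    (hg : g ∈ D.pseudoGrad u) (hgp : ∫⁻ x, g x ^ p ∂m < ∞) : D.MemSobolev u :=
  ⟨hu, (D.energy_le hg).trans_lt hgp⟩

lemma exists_lintegral_lt {u : X → ℝ} {c : ℝ≥0∞} (h : D.energy u Set.univ < c) :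
    ∃ g ∈ D.pseudoGrad u, ∫⁻ x, g x ^ p ∂m < c := by
  simp only [energy, iInf_lt_iff, Measure.restrict_univ] at h
  obtain ⟨g, hg, h⟩ := h
  exact ⟨g, hg, h⟩

/-- Midpoints of pseudo-gradients are pseudo-gradients, so two near-minimizers have a midpoint of
energy at least `E`; the convexity estimate then forces them to be close in `L^p`. -/
lemma exists_isMinimal (hp : 1 < p) {u : X → ℝ} (hu : D.MemSobolev u) :
    ∃ g, D.IsMinimal u g := by
  have hp0 : 0 < p := by linarith
  have hfact : Fact (1 ≤ ENNReal.ofReal p) := ⟨by simpa using hp.le⟩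
  have hne0 : ENNReal.ofReal p ≠ 0 := by simpa using hp0
  have htr : (ENNReal.ofReal p).toReal = p := ENNReal.toReal_ofReal hp0.le
  obtain ⟨hul, hE⟩ := hu
  set E := D.energy u Set.univ with hEdef
  have hex : ∀ n : ℕ, ∃ g ∈ D.pseudoGrad u, ∫⁻ x, g x ^ p ∂m < E + ((n : ℝ≥0∞) + 1)⁻¹ := by
    intro n
    exact D.exists_lintegral_lt (ENNReal.lt_add_right hE.ne (by simp))
  choose g hg hgE using hex
  have hgm : ∀ n, AEMeasurable (g n) m := fun n => D.aemeasurable u (g n) hul (hg n)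
  have hfin : ∀ n, ∫⁻ x, g n x ^ p ∂m < ∞ := fun n =>
    (hgE n).trans (ENNReal.add_lt_top.2 ⟨hE, by simp⟩)
  have hgt : ∀ n, ∀ᵐ x ∂m, g n x ≠ ∞ := fun n =>
    ae_ne_top_of_lintegral_rpow hp (hgm n) (hfin n)
  have hδ : Tendsto (fun n : ℕ => ((n : ℝ≥0∞) + 1)⁻¹) atTop (𝓝 0) := by
    have := (tendsto_add_atTop_iff_nat 1).2 ENNReal.tendsto_inv_nat_nhds_zero
    simpa using this
  set f : ℕ → X → ℝ := fun n x => (g n x).toReal with hf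
  have hfe : ∀ n, ∀ᵐ x ∂m, ‖f n x‖ₑ = g n x := fun n => by
    filter_upwards [hgt n] with x hx
    simp only [hf]
    rw [Real.enorm_eq_ofReal ENNReal.toReal_nonneg, ENNReal.ofReal_toReal hx]
  have hnorm : ∀ h : X → ℝ, eLpNorm h (ENNReal.ofReal p) m =
      (∫⁻ x, ‖h x‖ₑ ^ p ∂m) ^ (1 / p) := fun h => by
    rw [eLpNorm_eq_lintegral_rpow_enorm_toReal hne0 ENNReal.ofReal_ne_top, htr]
  have hfnorm : ∀ n, eLpNorm (f n) (ENNReal.ofReal p) m = (∫⁻ x, g n x ^ p ∂m) ^ (1 / p) := by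
    intro n
    rw [hnorm]
    congr 1
    exact lintegral_congr_ae ((hfe n).mono fun x hx => by simp only [hx])
  have hfL : ∀ n, MemLp (f n) (ENNReal.ofReal p) m := fun n => by
    refine ⟨(hgm n).ennreal_toReal.aestronglyMeasurable, ?_⟩
    rw [hfnorm]
    exact ENNReal.rpow_lt_top_of_nonneg (by positivity) (hfin n).ne
  -- the minimizing sequence is a Cauchy sequence
  have hI : Tendsto (fun n : ℕ × ℕ => ∫⁻ x, ‖f n.1 x - f n.2 x‖ₑ ^ p ∂m) atTop (𝓝 0) := by
    rw [ENNReal.tendsto_nhds_zero]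
    intro τ hτ
    have hτ2 : τ / 2 ≠ 0 := (ENNReal.half_pos hτ.ne').ne'
    -- Order of choices: `ε` absorbs the energy term `2 * E`, then `C` depends on `ε`, then the
    -- tolerance `η` absorbs `2 * (ε + C)`. Each contributes at most `τ / 2`.
    obtain ⟨ε, hε, hεE⟩ := ENNReal.exists_nnreal_pos_mul_lt
      (ENNReal.mul_ne_top ENNReal.ofNat_ne_top hE.ne : 2 * E ≠ ∞) hτ2
    obtain ⟨C, hC⟩ := exists_enorm_sub_rpow_add_le hp hε
    obtain ⟨η, hη, hηC⟩ := ENNReal.exists_nnreal_pos_mul_lt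
      (ENNReal.mul_ne_top ENNReal.ofNat_ne_top
        (ENNReal.add_ne_top.2 ⟨ENNReal.coe_ne_top, ENNReal.coe_ne_top⟩) :
        2 * ((ε : ℝ≥0∞) + C) ≠ ∞) hτ2
    have hev : ∀ᶠ n : ℕ in atTop, ((n : ℝ≥0∞) + 1)⁻¹ ≤ η :=
      (ENNReal.tendsto_nhds_zero.1 hδ) η (by simpa using hη)
    rw [← prod_atTop_atTop_eq]
    filter_upwards [hev.prod_mk hev] with n hn
    have hmid : E ≤ ∫⁻ x, (2⁻¹ * g n.1 x + 2⁻¹ * g n.2 x) ^ p ∂m := by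
      refine D.energy_le ?_
      have h1 := D.upper_linearity u u (g n.1) (g n.2)
        (fun x => 2⁻¹ * g n.1 x + 2⁻¹ * g n.2 x) (1 / 2) (1 / 2) hul hul (hg _) (hg _)
        (((hgm _).const_mul _).add ((hgm _).const_mul _)) (ae_of_all _ fun x => ?_)
      · have e : (fun x => (1 / 2 : ℝ) * u x + 1 / 2 * u x) = u := by funext x; ring
        rwa [e] at h1
      · have e : ‖(1 / 2 : ℝ)‖ₑ = 2⁻¹ := by
          rw [Real.enorm_eq_ofReal (by norm_num), one_div,
            ENNReal.ofReal_inv_of_pos (by norm_num)]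
          simp
        rw [e]
    have hint : ∫⁻ x, ‖f n.1 x - f n.2 x‖ₑ ^ p ∂m + 2 * C * E ≤
        (ε + C) * (∫⁻ x, g n.1 x ^ p ∂m + ∫⁻ x, g n.2 x ^ p ∂m) := by
      calc _ ≤ ∫⁻ x, ‖f n.1 x - f n.2 x‖ₑ ^ p ∂m +
            2 * C * ∫⁻ x, (2⁻¹ * g n.1 x + 2⁻¹ * g n.2 x) ^ p ∂m := by gcongr
        _ = ∫⁻ x, (‖f n.1 x - f n.2 x‖ₑ ^ p +
            2 * C * (2⁻¹ * g n.1 x + 2⁻¹ * g n.2 x) ^ p) ∂m := by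
          rw [lintegral_add_left', lintegral_const_mul' _ _
            (ENNReal.mul_ne_top ENNReal.ofNat_ne_top ENNReal.coe_ne_top)]
          exact (((hfL n.1).1.sub (hfL n.2).1).enorm).pow_const p
        _ ≤ ∫⁻ x, (ε + C) * (g n.1 x ^ p + g n.2 x ^ p) ∂m := by
          refine lintegral_mono_ae ?_
          filter_upwards [hgt n.1, hgt n.2] with x hx1 hx2
          exact hC _ _ hx1 hx2
        _ = _ := by
          rw [lintegral_const_mul' _ _
            (ENNReal.add_ne_top.2 ⟨ENNReal.coe_ne_top, ENNReal.coe_ne_top⟩),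
            lintegral_add_left' ((hgm _).pow_const p)]
    have hb : ∀ k : ℕ, ((k : ℝ≥0∞) + 1)⁻¹ ≤ η → ∫⁻ x, g k x ^ p ∂m ≤ E + η :=
      fun k hk => (hgE k).le.trans (by gcongr)
    have hfinal : ∫⁻ x, ‖f n.1 x - f n.2 x‖ₑ ^ p ∂m + 2 * C * E ≤
        (ε * (2 * E) + η * (2 * (ε + C))) + 2 * C * E := by
      refine hint.trans ?_
      calc _ ≤ ((ε : ℝ≥0∞) + C) * ((E + η) + (E + η)) := by
            gcongr
            · exact hb _ hn.1
            · exact hb _ hn.2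
        _ = _ := by ring
    -- The terms `2 * C * E` cancel because `E` is finite.
    have hcan := (ENNReal.add_le_add_iff_right
      (ENNReal.mul_ne_top (ENNReal.mul_ne_top ENNReal.ofNat_ne_top ENNReal.coe_ne_top)
        hE.ne)).1 hfinal
    refine hcan.trans ?_
    calc _ ≤ τ / 2 + τ / 2 := add_le_add hεE.le hηC.le
      _ = τ := ENNReal.add_halves τ
  have hcauchy : CauchySeq fun n => (hfL n).toLp (f n) := by
    rw [Lp.cauchySeq_Lp_iff_cauchySeq_eLpNorm]
    have h2 := (ENNReal.continuous_rpow_const (y := 1 / p)).tendsto 0 |>.comp hI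
    rw [ENNReal.zero_rpow_of_pos (by positivity)] at h2
    refine h2.congr fun n => ?_
    have : eLpNorm (⇑((hfL n.1).toLp (f n.1)) - ⇑((hfL n.2).toLp (f n.2))) (ENNReal.ofReal p) m =
        eLpNorm (f n.1 - f n.2) (ENNReal.ofReal p) m :=
      eLpNorm_congr_ae ((hfL n.1).coeFn_toLp.sub (hfL n.2).coeFn_toLp)
    rw [this, hnorm]
    rfl
  obtain ⟨F, hF⟩ := cauchySeq_tendsto_of_complete hcauchy
  have hFlim : Tendsto (fun n => eLpNorm (f n - ⇑F) (ENNReal.ofReal p) m) atTop (𝓝 0) := by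
    rw [Lp.tendsto_Lp_iff_tendsto_eLpNorm'] at hF
    refine hF.congr fun n => ?_
    exact eLpNorm_congr_ae ((hfL n).coeFn_toLp.sub EventuallyEq.rfl)
  have hFm := Lp.memLp F
  have hFle : ∫⁻ x, ‖F x‖ₑ ^ p ∂m ≤ E := by
    have h1 : Tendsto (fun n : ℕ => (E + ((n : ℝ≥0∞) + 1)⁻¹) ^ (1 / p) +
        eLpNorm (f n - ⇑F) (ENNReal.ofReal p) m) atTop (𝓝 (E ^ (1 / p))) := by
      have h2 := ((ENNReal.continuous_rpow_const (y := 1 / p)).tendsto (E + 0)).comp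
        (hδ.const_add E)
      simpa using h2.add hFlim
    have h3 : eLpNorm (⇑F) (ENNReal.ofReal p) m ≤ E ^ (1 / p) := by
      refine ge_of_tendsto' h1 fun n => ?_
      have e : ⇑F = f n - (f n - ⇑F) := by funext x; simp
      calc eLpNorm (⇑F) (ENNReal.ofReal p) m
          = eLpNorm (f n - (f n - ⇑F)) (ENNReal.ofReal p) m := by rw [← e]
        _ ≤ eLpNorm (f n) (ENNReal.ofReal p) m + eLpNorm (f n - ⇑F) (ENNReal.ofReal p) m :=
          eLpNorm_sub_le (hfL n).1 ((hfL n).1.sub hFm.1) hfact.out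
        _ ≤ _ := by
          gcongr
          rw [hfnorm]
          exact ENNReal.rpow_le_rpow (hgE n).le (by positivity)
    rw [hnorm] at h3
    exact (ENNReal.rpow_le_rpow_iff (by positivity)).1 h3
  -- The `L^p` limit `F` is a signed real class; its absolute value is also the limit, since the `f
  -- n` are nonnegative.
  have hmem : (fun x => ‖F x‖ₑ) ∈ D.pseudoGrad u := by
    refine D.completeness (fun _ => u) g u _ (fun _ => hul) (fun n => ⟨hgm n, hfin n⟩) hg hul
      ⟨hFm.1.enorm, hFle.trans_lt hE⟩ (fun B _ _ => by simp) ?_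
    refine tendsto_of_tendsto_of_tendsto_of_le_of_le tendsto_const_nhds hFlim
      (fun _ => zero_le) fun n => eLpNorm_mono fun x => ?_
    simp only [toReal_enorm, Pi.sub_apply, Real.norm_eq_abs]
    have : (g n x).toReal = |f n x| := (abs_of_nonneg ENNReal.toReal_nonneg).symm
    rw [this]
    exact abs_abs_sub_abs_le _ _
  exact ⟨_, hmem, le_antisymm (D.energy_le hmem) hFle⟩

lemma isMinimal_minGrad (hp : 1 < p) {u : X → ℝ} (hu : D.MemSobolev u) :
    D.IsMinimal u (D.minGrad u) :=
  Classical.epsilon_spec (D.exists_isMinimal hp hu)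

lemma minGrad_mem (hp : 1 < p) {u : X → ℝ} (hu : D.MemSobolev u) :
    D.minGrad u ∈ D.pseudoGrad u := (D.isMinimal_minGrad hp hu).1

lemma lintegral_minGrad_lt_top (hp : 1 < p) {u : X → ℝ} (hu : D.MemSobolev u) :
    ∫⁻ x, D.minGrad u x ^ p ∂m < ∞ := (D.isMinimal_minGrad hp hu).2 ▸ hu.2

lemma aemeasurable_minGrad (hp : 1 < p) {u : X → ℝ} (hu : D.MemSobolev u) :
    AEMeasurable (D.minGrad u) m := D.aemeasurable u _ hu.1 (D.minGrad_mem hp hu)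

lemma minGrad_ne_top (hp : 1 < p) {u : X → ℝ} (hu : D.MemSobolev u) :
    ∀ᵐ x ∂m, D.minGrad u x ≠ ∞ :=
  ae_ne_top_of_lintegral_rpow hp (D.aemeasurable_minGrad hp hu) (D.lintegral_minGrad_lt_top hp hu)

variable {D}

/-- Two functions ordered a.e. whose `p`-th powers have the same finite integral coincide a.e. -/
lemma IsMinimal.ae_eq_minGrad (hp : 1 < p) (hD : D.MinGradLe) {u : X → ℝ}
    (hu : D.MemSobolev u) {g : X → ℝ≥0∞} (hg : D.IsMinimal u g) : g =ᵐ[m] D.minGrad u := by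
  have hp0 : 0 < p := by linarith
  have h1 := hD u g hu hg.1
  have hm := D.aemeasurable u g hu.1 hg.1
  have h2 : (fun x => D.minGrad u x ^ p) =ᵐ[m] fun x => g x ^ p := by
    refine ae_eq_of_ae_le_of_lintegral_le (h1.mono fun x hx => ENNReal.rpow_le_rpow hx hp0.le)
      (D.lintegral_minGrad_lt_top hp hu).ne (hm.pow_const p) ?_
    rw [← hg.2, (D.isMinimal_minGrad hp hu).2]
  filter_upwards [h2] with x hx
  exact (ENNReal.rpow_left_injective hp0.ne' hx).symm

end Minimal

end DStructure

/-! ### Approximation of Lipschitz functions by modifying the derivative. -/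

section Primitive

/-- Order-connectedness keeps the integral between two points of `s` inside `s`, so a bound on `ξ`
there is enough. -/
lemma lipschitzOnWith_primitive {ξ : ℝ → ℝ} (hξ : ∀ a b : ℝ, IntervalIntegrable ξ volume a b)
    {s : Set ℝ} (hs : s.OrdConnected) {c : ℝ≥0} (hc : ∀ᵐ t, t ∈ s → |ξ t| ≤ c) (C : ℝ) :
    LipschitzOnWith c (fun t => C + ∫ r in (0 : ℝ)..t, ξ r) s := by
  refine LipschitzOnWith.of_dist_le_mul fun x hx y hy => ?_
  rw [Real.dist_eq, Real.dist_eq, add_sub_add_left_eq_sub,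
    intervalIntegral.integral_interval_sub_left (hξ _ _) (hξ _ _), ← Real.norm_eq_abs]
  refine intervalIntegral.norm_integral_le_of_norm_le_const_ae (hc.mono fun t ht hts => ?_)
  exact ht (hs.uIcc_subset hy hx (Set.uIoc_subset_uIcc hts))

lemma LipschitzWith.intervalIntegrable_indicator_deriv {φ : ℝ → ℝ} {L : ℝ≥0}
    (hφ : LipschitzWith L φ) {s : Set ℝ} (hs : MeasurableSet s) (a b : ℝ) :
    IntervalIntegrable (s.indicator (deriv φ)) volume a b := by
  refine (intervalIntegrable_const (c := (L : ℝ))).mono_fun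
    ((measurable_deriv φ).indicator hs).aestronglyMeasurable (ae_of_all _ fun t => ?_)
  refine (norm_indicator_le_norm_self _ _).trans ?_
  exact (norm_deriv_le_of_lipschitz hφ).trans (le_abs_self _)

/-- A Lipschitz function whose derivative is bounded by `c` on a set `A` of finite measure can be
approximated by a Lipschitz function that is `c`-Lipschitz on the intervals of a neighbourhood
of `A`. -/
lemma LipschitzWith.exists_approx {φ : ℝ → ℝ} {L : ℝ≥0} (hφ : LipschitzWith L φ) {A : Set ℝ}
    (hA : MeasurableSet A) (hAfin : volume A ≠ ∞) {c : ℝ≥0}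
    (hAc : ∀ᵐ t, t ∈ A → |deriv φ t| ≤ c) {ε : ℝ} (hε : 0 < ε) :
    ∃ (θ : ℝ → ℝ) (U : Set ℝ), LipschitzWith L θ ∧ A ⊆ U ∧ IsOpen U ∧
      (∀ s ⊆ U, s.OrdConnected → LipschitzOnWith c θ s) ∧ ∀ t, |θ t - φ t| ≤ L * ε := by
  obtain ⟨U, hAU, hUo, -, hU⟩ := hA.exists_isOpen_sdiff_lt hAfin
    (ε := ENNReal.ofReal ε) (by simpa using hε)
  have hm : MeasurableSet (U \ A) := hUo.measurableSet.diff hA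
  have hφb : ∀ t, |deriv φ t| ≤ L := fun t => norm_deriv_le_of_lipschitz hφ
  have hint := fun (s : Set ℝ) (hs : MeasurableSet s) => hφ.intervalIntegrable_indicator_deriv hs
  -- The derivative is erased on `U \ A`: what remains in `U` is bounded by `c`, and the error is at
  -- most `L` times the measure of `U \ A`.
  refine ⟨fun t => φ 0 + ∫ r in (0 : ℝ)..t, (U \ A)ᶜ.indicator (deriv φ) r, U, ?_, hAU, hUo,
    fun s hs hso => ?_, fun t => ?_⟩
  · rw [← lipschitzOnWith_univ]
    refine lipschitzOnWith_primitive (hint _ hm.compl) Set.ordConnected_univ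
      (ae_of_all _ fun t _ => ?_) _
    exact (norm_indicator_le_norm_self (deriv φ) t).trans (hφb t)
  · refine lipschitzOnWith_primitive (hint _ hm.compl) hso (hAc.mono fun t ht hts => ?_) _
    by_cases hta : t ∈ A
    · exact (norm_indicator_le_norm_self (deriv φ) t).trans (ht hta)
    · have hn : t ∉ (U \ A)ᶜ := fun h => h ⟨hs hts, hta⟩
      rw [Set.indicator_of_notMem hn, abs_zero]
      exact c.coe_nonneg
  · have h1 : φ t = φ 0 + ∫ r in (0 : ℝ)..t, deriv φ r := by
      rw [(hφ.lipschitzOnWith.absolutelyContinuousOnInterval).integral_deriv_eq_sub]; ring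
    have h2 : ∫ r in (0 : ℝ)..t, deriv φ r = (∫ r in (0 : ℝ)..t, (U \ A)ᶜ.indicator (deriv φ) r) +
        ∫ r in (0 : ℝ)..t, (U \ A).indicator (deriv φ) r := by
      rw [← intervalIntegral.integral_add (hint _ hm.compl _ _) (hint _ hm _ _)]
      congr 1
      funext r
      exact (Set.indicator_compl_add_self_apply _ _ _).symm
    have hvol : volume.real (U \ A) ≤ ε := ENNReal.toReal_le_of_le_ofReal hε.le hU.le
    rw [h1, h2, add_sub_add_left_eq_sub, sub_add_cancel_left, abs_neg]
    calc ‖∫ r in (0 : ℝ)..t, (U \ A).indicator (deriv φ) r‖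
        = ‖∫ r in Set.uIoc 0 t, (U \ A).indicator (deriv φ) r‖ :=
          intervalIntegral.norm_integral_eq_norm_integral_uIoc _
      _ = ‖∫ r in Set.uIoc 0 t ∩ (U \ A), deriv φ r‖ := by rw [setIntegral_indicator hm]
      _ ≤ L * volume.real (Set.uIoc 0 t ∩ (U \ A)) := by
          refine norm_setIntegral_le_of_norm_le_const ?_ fun r _ => hφb r
          exact (measure_mono Set.inter_subset_right).trans_lt (hU.trans ENNReal.ofReal_lt_top)
      _ ≤ L * ε := by
          gcongr
          exact (measureReal_mono Set.inter_subset_right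
            (hU.trans ENNReal.ofReal_lt_top).ne).trans hvol

end Primitive

/-! ### Locality and the chain rule. -/

lemma lintegral_rpow_lt_top_of_ae_le_mul {X : Type*} [MeasurableSpace X] {m : Measure X} {p : ℝ}
    (hp : 0 ≤ p) {g h : X → ℝ≥0∞} {C : ℝ≥0} (hgh : ∀ᵐ x ∂m, g x ≤ C * h x)
    (hh : ∫⁻ x, h x ^ p ∂m < ∞) : ∫⁻ x, g x ^ p ∂m < ∞ := by
  have hC : (C : ℝ≥0∞) ^ p ≠ ∞ := ENNReal.rpow_ne_top_of_nonneg hp ENNReal.coe_ne_top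
  calc ∫⁻ x, g x ^ p ∂m ≤ ∫⁻ x, (C : ℝ≥0∞) ^ p * h x ^ p ∂m := by
        refine lintegral_mono_ae (hgh.mono fun x hx => ?_)
        rw [← ENNReal.mul_rpow_of_nonneg _ _ hp]
        exact ENNReal.rpow_le_rpow hx hp
    _ = (C : ℝ≥0∞) ^ p * ∫⁻ x, h x ^ p ∂m := lintegral_const_mul' _ _ hC
    _ < ∞ := ENNReal.mul_lt_top hC.lt_top hh

namespace DStructure

section Sobolev

variable {X : Type*} [MetricSpace X] [MeasurableSpace X] {m : Measure X} {p : ℝ}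
  {D : DStructure m p}

lemma MemSobolev.add {u v : X → ℝ} (hp : 1 < p) (hu : D.MemSobolev u) (hv : D.MemSobolev v) :
    D.MemSobolev (fun x => u x + v x) :=
  D.memSobolev_of_mem (hu.1.add hv.1)
    (D.add_mem hu.1 hv.1 (D.minGrad_mem hp hu) (D.minGrad_mem hp hv))
    (ENNReal.lintegral_rpow_add_lt_top_of_lintegral_rpow_lt_top (D.aemeasurable_minGrad hp hu)
      (D.lintegral_minGrad_lt_top hp hu) (D.lintegral_minGrad_lt_top hp hv) hp.le)

lemma MemSobolev.const_mul {u : X → ℝ} (hp : 1 < p) (hu : D.MemSobolev u) (c : ℝ) :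
    D.MemSobolev (fun x => c * u x) :=
  D.memSobolev_of_mem (hu.1.const_mul c) (D.const_mul_mem hu.1 (D.minGrad_mem hp hu) c)
    (lintegral_rpow_lt_top_of_ae_le_mul (C := ‖c‖₊) (by linarith)
      (ae_of_all _ fun _ => le_rfl) (D.lintegral_minGrad_lt_top hp hu))

lemma MemSobolev.lipschitz_comp (hball : ∀ (x : X) (r : ℝ), m (Metric.ball x r) < ∞)
    {u : X → ℝ} (hp : 1 < p) (hu : D.MemSobolev u) {L : ℝ≥0} {φ : ℝ → ℝ}
    (hφ : LipschitzWith L φ) : D.MemSobolev (φ ∘ u) :=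
  D.memSobolev_of_mem (hu.1.lipschitz_comp hball hφ)
    (D.lipschitz_comp_mem hball hp hu.1 (D.minGrad_mem hp hu)
      (D.lintegral_minGrad_lt_top hp hu) hφ)
    (lintegral_rpow_lt_top_of_ae_le_mul (C := L) (by linarith)
      (ae_of_all _ fun _ => le_rfl) (D.lintegral_minGrad_lt_top hp hu))

lemma minGrad_add_le (hp : 1 < p) (hD : D.MinGradLe) {u v : X → ℝ} (hu : D.MemSobolev u)
    (hv : D.MemSobolev v) :
    ∀ᵐ x ∂m, D.minGrad (fun x => u x + v x) x ≤ D.minGrad u x + D.minGrad v x :=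
  hD _ _ (hu.add hp hv) (D.add_mem hu.1 hv.1 (D.minGrad_mem hp hu) (D.minGrad_mem hp hv))

lemma minGrad_const_mul_le (hp : 1 < p) (hD : D.MinGradLe) {u : X → ℝ} (hu : D.MemSobolev u)
    (c : ℝ) : ∀ᵐ x ∂m, D.minGrad (fun x => c * u x) x ≤ ‖c‖ₑ * D.minGrad u x :=
  hD _ _ (hu.const_mul hp c) (D.const_mul_mem hu.1 (D.minGrad_mem hp hu) c)

lemma minGrad_comp_le_lipschitz (hball : ∀ (x : X) (r : ℝ), m (Metric.ball x r) < ∞)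
    (hp : 1 < p) (hD : D.MinGradLe) {u : X → ℝ} (hu : D.MemSobolev u) {L : ℝ≥0} {φ : ℝ → ℝ}
    (hφ : LipschitzWith L φ) : ∀ᵐ x ∂m, D.minGrad (φ ∘ u) x ≤ L * D.minGrad u x :=
  hD _ _ (hu.lipschitz_comp hball hp hφ) (D.lipschitz_comp_mem hball hp hu.1
    (D.minGrad_mem hp hu) (D.lintegral_minGrad_lt_top hp hu) hφ)

/-- Every competitor for the energy on the set dominates `minGrad` a.e., so the vanishing of the
infimum forces `minGrad` to vanish there. Null-measurability is the natural hypothesis since `u` is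
only a.e. measurable. -/
lemma minGrad_eq_zero_of_const (hp : 1 < p) (hD : D.PointwiseLocal) {u : X → ℝ}
    (hu : D.MemSobolev u) {s : Set X} (hs : NullMeasurableSet s m) {c : ℝ}
    (hc : ∀ᵐ x ∂m, x ∈ s → u x = c) : ∀ᵐ x ∂m, x ∈ s → D.minGrad u x = 0 := by
  have hp0 : 0 < p := by linarith
  obtain ⟨t, hts, htm, hte⟩ := hs.exists_measurable_subset_ae_eq
  have hE := hD.1 t u htm hu ⟨c, hc.mono fun x hx hxt => hx (hts hxt)⟩
  have h1 : ∫⁻ x in t, D.minGrad u x ^ p ∂m = 0 := by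
    refine le_antisymm ?_ zero_le
    rw [← hE]
    refine le_iInf₂ fun g hg => lintegral_mono_ae (ae_restrict_of_ae ?_)
    exact (hD.2 u g hu hg).mono fun x hx => ENNReal.rpow_le_rpow hx hp0.le
  rw [lintegral_eq_zero_iff' ((D.aemeasurable_minGrad hp hu).pow_const p).restrict,
    EventuallyEq, ae_restrict_iff' htm] at h1
  filter_upwards [h1, hte.mem_iff] with x hx hxe hxs
  simpa [hp0, hp0.not_gt] using hx (hxe.2 hxs)

/-- Write `u = v + (u - v)`: the second summand is zero on `s`, so it contributes nothing there. -/
lemma minGrad_le_of_ae_eq_on (hp : 1 < p) (hD : D.PointwiseLocal) {u v : X → ℝ}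
    (hu : D.MemSobolev u) (hv : D.MemSobolev v) {s : Set X} (hs : NullMeasurableSet s m)
    (huv : ∀ᵐ x ∂m, x ∈ s → u x = v x) :
    ∀ᵐ x ∂m, x ∈ s → D.minGrad u x ≤ D.minGrad v x := by
  have hw := hu.add hp (hv.const_mul hp (-1))
  have h0 := minGrad_eq_zero_of_const hp hD hw hs (c := 0)
    (huv.mono fun x hx hxs => by rw [hx hxs]; ring)
  have h1 := minGrad_add_le hp hD.2 hv hw
  have e : (fun x => v x + (u x + -1 * v x)) = u := by funext x; ring
  rw [e] at h1
  filter_upwards [h0, h1] with x hx0 hx1 hxs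
  rwa [hx0 hxs, add_zero] at hx1

/-- Localized version of `minGrad_comp_le_lipschitz`. -/
lemma minGrad_comp_le_of_isOpen (hball : ∀ (x : X) (r : ℝ), m (Metric.ball x r) < ∞)
    (hp : 1 < p) (hD : D.PointwiseLocal) {u : X → ℝ} (hu : D.MemSobolev u) {L c : ℝ≥0}
    {φ : ℝ → ℝ} (hφ : LipschitzWith L φ) {U : Set ℝ} (hU : IsOpen U)
    (hc : ∀ s ⊆ U, s.OrdConnected → LipschitzOnWith c φ s) :
    ∀ᵐ x ∂m, u x ∈ U → D.minGrad (φ ∘ u) x ≤ c * D.minGrad u x := by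
  -- Rational intervals cover `U` at the cost of countably many null sets. On each, `φ` agrees with
  -- a globally `c`-Lipschitz extension `θ`, to which the crude bound applies.
  have key : ∀ q : ℚ × ℚ, ∀ᵐ x ∂m, Set.Ioo (q.1 : ℝ) q.2 ⊆ U → u x ∈ Set.Ioo (q.1 : ℝ) q.2 →
      D.minGrad (φ ∘ u) x ≤ c * D.minGrad u x := by
    intro q
    by_cases hq : Set.Ioo (q.1 : ℝ) q.2 ⊆ U
    · obtain ⟨θ, hθ, hθe⟩ := (hc _ hq Set.ordConnected_Ioo).extend_real
      have hs : NullMeasurableSet {x | u x ∈ Set.Ioo (q.1 : ℝ) q.2} m :=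
        hu.1.1.aemeasurable.nullMeasurableSet_preimage measurableSet_Ioo
      have h1 := minGrad_le_of_ae_eq_on hp hD (hu.lipschitz_comp hball hp hφ)
        (hu.lipschitz_comp hball hp hθ) hs (ae_of_all _ fun x hx => hθe hx)
      filter_upwards [h1, minGrad_comp_le_lipschitz hball hp hD.2 hu hθ] with x hx1 hx2 _ hxs
      exact (hx1 hxs).trans hx2
    · exact ae_of_all _ fun x h => absurd h hq
  filter_upwards [ae_all_iff.2 key] with x hx hxU
  obtain ⟨a, b, hab, hsub⟩ := mem_nhds_iff_exists_Ioo_subset.1 (hU.mem_nhds hxU)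
  obtain ⟨q₁, h1, h1'⟩ := exists_rat_btwn hab.1
  obtain ⟨q₂, h2, h2'⟩ := exists_rat_btwn hab.2
  exact hx (q₁, q₂) ((Set.Ioo_subset_Ioo h1.le h2'.le).trans hsub) ⟨h1', h2⟩

lemma minGrad_comp_le_of_abs_deriv_le (hball : ∀ (x : X) (r : ℝ), m (Metric.ball x r) < ∞)
    (hp : 1 < p) (hD : D.PointwiseLocal) {u : X → ℝ} (hu : D.MemSobolev u) {L c : ℝ≥0}
    {φ : ℝ → ℝ} (hφ : LipschitzWith L φ) {A : Set ℝ} (hA : MeasurableSet A)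
    (hAc : ∀ᵐ t, t ∈ A → |deriv φ t| ≤ c) :
    ∀ᵐ x ∂m, u x ∈ A → D.minGrad (φ ∘ u) x ≤ c * D.minGrad u x := by
  classical
  -- The approximation needs finite measure; in general `A` is exhausted by bounded pieces.
  wlog hAfin : volume A ≠ ∞ generalizing A
  · have h := fun k : ℕ => this (hA.inter (measurableSet_Icc (a := -(k : ℝ)) (b := k)))
      (hAc.mono fun t ht hta => ht hta.1)
      ((measure_mono Set.inter_subset_right).trans_lt measure_Icc_lt_top).ne
    filter_upwards [ae_all_iff.2 h] with x hx hxA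
    obtain ⟨k, hk⟩ := exists_nat_ge |u x|
    exact hx k ⟨hxA, abs_le.1 hk⟩
  have hex := fun n : ℕ => hφ.exists_approx hA hAfin hAc (Nat.one_div_pos_of_nat (α := ℝ) (n := n))
  choose θ U hθ hAU hUo hθc hθφ using hex
  -- The weight is independent of `n`: it gives one pseudo-gradient common to all `θ n ∘ u`, which
  -- completeness passes on to `φ ∘ u`.
  set κ : ℝ → ℝ≥0∞ := A.piecewise (fun _ => (c : ℝ≥0∞)) (fun _ => (L : ℝ≥0∞)) with hκ
  have hκm : Measurable κ := Measurable.piecewise hA measurable_const measurable_const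
  set g : X → ℝ≥0∞ := fun x => κ (u x) * D.minGrad u x with hg
  have hgm : AEMeasurable g m :=
    (hκm.comp_aemeasurable hu.1.1.aemeasurable).mul (D.aemeasurable_minGrad hp hu)
  have hgp : ∫⁻ x, g x ^ p ∂m < ∞ := by
    refine lintegral_rpow_lt_top_of_ae_le_mul (C := max c L) (by linarith)
      (ae_of_all _ fun x => ?_) (D.lintegral_minGrad_lt_top hp hu)
    refine mul_le_mul_left ?_ _
    by_cases h : u x ∈ A <;> simp [hκ, h]
  have hmem : ∀ n, g ∈ D.pseudoGrad (θ n ∘ u) := by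
    intro n
    have hw := hu.lipschitz_comp hball hp (hθ n)
    refine D.mem_of_le hw.1 (D.minGrad_mem hp hw) hgm ?_
    filter_upwards [minGrad_comp_le_lipschitz hball hp hD.2 hu (hθ n),
      minGrad_comp_le_of_isOpen hball hp hD hu (hθ n) (hUo n) (hθc n)] with x hx1 hx2
    by_cases h : u x ∈ A
    · simpa [hg, hκ, h] using hx2 (hAU n h)
    · simpa [hg, hκ, h] using hx1
  have hlim : ∀ t, Tendsto (fun n => θ n t) atTop (𝓝 (φ t)) := by
    intro t
    rw [tendsto_iff_dist_tendsto_zero]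
    have h0 : Tendsto (fun n : ℕ => (L : ℝ) * (1 / ((n : ℝ) + 1))) atTop (𝓝 0) := by
      simpa using (tendsto_one_div_add_atTop_nhds_zero_nat (𝕜 := ℝ)).const_mul (L : ℝ)
    exact squeeze_zero (fun _ => dist_nonneg) (fun n => hθφ n t) h0
  have hfin := D.mem_comp_of_tendsto hball hp hu.1 hθ hφ hlim hmem hgp
  filter_upwards [hD.2 _ _ (hu.lipschitz_comp hball hp hφ) hfin] with x hx hxA
  simpa [hg, hκ, hxA] using hx

/-- Apply the previous bound on the sublevel sets of `|ψ|` at rational heights. The freedom in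
choosing the Borel version `ψ` is what yields the vanishing on preimages of null sets. -/
lemma minGrad_comp_le (hball : ∀ (x : X) (r : ℝ), m (Metric.ball x r) < ∞)
    (hp : 1 < p) (hD : D.PointwiseLocal) {u : X → ℝ} (hu : D.MemSobolev u) {L : ℝ≥0}
    {φ : ℝ → ℝ} (hφ : LipschitzWith L φ) {ψ : ℝ → ℝ} (hψ : Measurable ψ)
    (hψφ : ψ =ᵐ[volume] deriv φ) :
    ∀ᵐ x ∂m, D.minGrad (φ ∘ u) x ≤ ‖ψ (u x)‖ₑ * D.minGrad u x := by
  have key : ∀ q : ℚ, ∀ᵐ x ∂m, u x ∈ {t | |ψ t| ≤ Real.toNNReal q} →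
      D.minGrad (φ ∘ u) x ≤ Real.toNNReal q * D.minGrad u x := by
    intro q
    refine minGrad_comp_le_of_abs_deriv_le hball hp hD hu hφ
      (measurableSet_le hψ.abs measurable_const) (hψφ.mono fun t ht hta => ?_)
    rw [← ht]; exact hta
  filter_upwards [ae_all_iff.2 key, D.minGrad_ne_top hp hu] with x hx hfin
  by_contra! hlt
  -- If `minGrad u` vanishes at `x`, any rational above `|ψ (u x)|` gives a contradiction; otherwise
  -- one divides and picks a rational strictly in between.
  rcases eq_or_ne (D.minGrad u x) 0 with h0 | h0
  · obtain ⟨q, hq⟩ := exists_rat_gt |ψ (u x)|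
    have := hx q (hq.le.trans (Real.le_coe_toNNReal _))
    simp only [h0, mul_zero] at this hlt
    exact absurd hlt this.not_gt
  · rw [← ENNReal.lt_div_iff_mul_lt (Or.inl h0) (Or.inl hfin)] at hlt
    obtain ⟨q, -, h1, h2⟩ := ENNReal.lt_iff_exists_rat_btwn.1 hlt
    rw [ENNReal.lt_div_iff_mul_lt (Or.inl h0) (Or.inl hfin)] at h2
    refine absurd h2 (hx q ?_).not_gt
    rw [Real.enorm_eq_ofReal_abs] at h1
    have := (ENNReal.coe_lt_coe.1 h1).le
    exact (Real.toNNReal_le_iff_le_coe).1 this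

/-- The indicator of `Nᶜ` is a version of the derivative of the identity. -/
lemma minGrad_eq_zero_of_null (hball : ∀ (x : X) (r : ℝ), m (Metric.ball x r) < ∞)
    (hp : 1 < p) (hD : D.PointwiseLocal) {u : X → ℝ} (hu : D.MemSobolev u) {N : Set ℝ}
    (hN : MeasurableSet N) (hN0 : volume N = 0) :
    ∀ᵐ x ∂m, x ∈ u ⁻¹' N → D.minGrad u x = 0 := by
  have h := minGrad_comp_le hball hp hD hu LipschitzWith.id
    (ψ := Nᶜ.indicator fun _ => 1) (measurable_const.indicator hN.compl) (by
      filter_upwards [compl_mem_ae_iff.2 hN0] with t ht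
      rw [Set.indicator_of_mem ht]
      simp)
  filter_upwards [h] with x hx hxN
  have hxN' : u x ∈ N := hxN
  simpa [hxN'] using hx

lemma abs_deriv_comp_mul_minGrad_ae_eq (hball : ∀ (x : X) (r : ℝ), m (Metric.ball x r) < ∞)
    (hp : 1 < p) (hD : D.PointwiseLocal) {u : X → ℝ} (hu : D.MemSobolev u) {ψ₁ ψ₂ : ℝ → ℝ}
    (h : ψ₁ =ᵐ[volume] ψ₂) :
    (fun x => ‖ψ₁ (u x)‖ₑ * D.minGrad u x) =ᵐ[m] fun x => ‖ψ₂ (u x)‖ₑ * D.minGrad u x := by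
  have hN0 : volume (toMeasurable volume {t | ¬ ψ₁ t = ψ₂ t}) = 0 := by
    rw [measure_toMeasurable]; exact h
  filter_upwards [minGrad_eq_zero_of_null hball hp hD hu (measurableSet_toMeasurable _ _) hN0]
    with x hx
  by_cases hxe : ψ₁ (u x) = ψ₂ (u x)
  · rw [hxe]
  · rw [hx (subset_toMeasurable _ _ hxe), mul_zero, mul_zero]

/-- Split `L u = φ ∘ u + (L u - φ ∘ u)` and use the upper bound on the second summand. Where `0 ≤ φ'
≤ L`, the weights `φ'` and `L - φ'` add up to exactly `L`, so the second one cancels. -/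
lemma le_minGrad_comp_of_deriv_nonneg (hball : ∀ (x : X) (r : ℝ), m (Metric.ball x r) < ∞)
    (hp : 1 < p) (hD : D.PointwiseLocal) {u : X → ℝ} (hu : D.MemSobolev u) {L : ℝ≥0}
    (hL : 0 < L) {φ : ℝ → ℝ} (hφ : LipschitzWith L φ) :
    ∀ᵐ x ∂m, 0 ≤ deriv φ (u x) → ‖deriv φ (u x)‖ₑ * D.minGrad u x ≤ D.minGrad (φ ∘ u) x := by
  have hLr : (0 : ℝ) < L := hL
  have hlin : LipschitzWith L (fun t : ℝ => (L : ℝ) * t) :=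
    LipschitzWith.of_dist_le_mul fun x y => by
      rw [Real.dist_eq, Real.dist_eq, ← mul_sub, abs_mul, abs_of_pos hLr]
  have hθ : LipschitzWith (L + L) (fun t => (L : ℝ) * t - φ t) := hlin.sub hφ
  have hθd : (fun t => (L : ℝ) - deriv φ t) =ᵐ[volume] deriv fun t => (L : ℝ) * t - φ t := by
    filter_upwards [hφ.ae_differentiableAt_real] with t ht
    have := ((hasDerivAt_id t).const_mul (L : ℝ)).sub ht.hasDerivAt
    simp only [mul_one] at this
    exact this.deriv.symm
  have h1 := minGrad_comp_le hball hp hD hu hθ ((measurable_deriv φ).const_sub _) hθd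
  have hφu := hu.lipschitz_comp hball hp hφ
  have hθu := hu.lipschitz_comp hball hp hθ
  have h2 := minGrad_add_le hp hD.2 hφu hθu
  have e2 : (fun x => (φ ∘ u) x + ((fun t => (L : ℝ) * t - φ t) ∘ u) x) =
      fun x => (L : ℝ) * u x := by funext x; simp
  rw [e2] at h2
  -- Homogeneity is so far only an inequality; scaling back by `L⁻¹` provides the missing direction.
  have h3 := minGrad_const_mul_le hp hD.2 (hu.const_mul hp L) (L : ℝ)⁻¹
  have e3 : (fun x => (L : ℝ)⁻¹ * ((L : ℝ) * u x)) = u := by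
    funext x; rw [inv_mul_cancel_left₀ hLr.ne']
  rw [e3] at h3
  filter_upwards [h1, h2, h3, D.minGrad_ne_top hp hu] with x hx1 hx2 hx3 hfin h0
  have hb : deriv φ (u x) ≤ L := (le_abs_self _).trans (norm_deriv_le_of_lipschitz hφ)
  have h4 : (L : ℝ≥0∞) * D.minGrad u x ≤ D.minGrad (fun x => (L : ℝ) * u x) x := by
    calc (L : ℝ≥0∞) * D.minGrad u x
        ≤ L * (‖(L : ℝ)⁻¹‖ₑ * D.minGrad (fun x => (L : ℝ) * u x) x) := by gcongr
      _ = D.minGrad (fun x => (L : ℝ) * u x) x := by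
        rw [← mul_assoc]
        have : (L : ℝ≥0∞) * ‖(L : ℝ)⁻¹‖ₑ = 1 := by
          rw [Real.enorm_eq_ofReal (by positivity), ENNReal.ofReal_inv_of_pos hLr,
            ENNReal.ofReal_coe_nnreal]
          exact ENNReal.mul_inv_cancel (by simpa using hL.ne') ENNReal.coe_ne_top
        rw [this, one_mul]
  have h5 : (L : ℝ≥0∞) = ‖deriv φ (u x)‖ₑ + ‖(L : ℝ) - deriv φ (u x)‖ₑ := by
    rw [Real.enorm_eq_ofReal h0, Real.enorm_eq_ofReal (by linarith),
      ← ENNReal.ofReal_add h0 (by linarith), add_sub_cancel, ENNReal.ofReal_coe_nnreal]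
  have h6 : ‖deriv φ (u x)‖ₑ * D.minGrad u x + ‖(L : ℝ) - deriv φ (u x)‖ₑ * D.minGrad u x ≤
      D.minGrad (φ ∘ u) x + ‖(L : ℝ) - deriv φ (u x)‖ₑ * D.minGrad u x := by
    rw [← add_mul, ← h5]
    exact h4.trans (hx2.trans (by gcongr))
  exact (ENNReal.add_le_add_iff_right (ENNReal.mul_ne_top enorm_ne_top hfin)).1 h6

/-- The chain rule for the minimal pseudo-gradient. -/
lemma minGrad_comp_ae_eq (hball : ∀ (x : X) (r : ℝ), m (Metric.ball x r) < ∞)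
    (hp : 1 < p) (hD : D.PointwiseLocal) {u : X → ℝ} (hu : D.MemSobolev u) {L : ℝ≥0}
    {φ : ℝ → ℝ} (hφ : LipschitzWith L φ) {φ' : ℝ → ℝ} (hφ' : φ' =ᵐ[volume] deriv φ) :
    D.minGrad (φ ∘ u) =ᵐ[m] fun x => ‖φ' (u x)‖ₑ * D.minGrad u x := by
  refine EventuallyEq.trans ?_ (abs_deriv_comp_mul_minGrad_ae_eq hball hp hD hu hφ').symm
  -- The lower bound needs a strictly positive Lipschitz constant.
  have hφ1 : LipschitzWith (L + 1) φ := hφ.weaken le_self_add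
  have hL : 0 < L + 1 := by positivity
  have hnφ := hφ1.neg
  have hneg := minGrad_const_mul_le hp hD.2 (hu.lipschitz_comp hball hp hφ) (-1)
  have e : (fun x => (-1 : ℝ) * (φ ∘ u) x) = (fun t => -φ t) ∘ u := by funext x; simp
  rw [e] at hneg
  filter_upwards [minGrad_comp_le hball hp hD hu hφ (measurable_deriv φ) EventuallyEq.rfl,
    le_minGrad_comp_of_deriv_nonneg hball hp hD hu hL hφ1,
    le_minGrad_comp_of_deriv_nonneg hball hp hD hu hL hnφ, hneg] with x h1 h2 h3 h4
  refine le_antisymm h1 ?_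
  rcases le_total 0 (deriv φ (u x)) with h | h
  · exact h2 h
  · have hd : deriv (fun t => -φ t) (u x) = -deriv φ (u x) := deriv.fun_neg
    have h5 := h3 (by change 0 ≤ deriv (fun t => -φ t) (u x); rw [hd]; linarith)
    change ‖deriv (fun t => -φ t) (u x)‖ₑ * _ ≤ _ at h5
    rw [hd, enorm_neg] at h5
    refine h5.trans (h4.trans ?_)
    simp

end Sobolev

end DStructure

/-! ### Real-variable estimates for the product. -/

section RealInequalities

/-- Optimization over the scaling parameter in the polarized product estimate. -/
lemma le_add_of_forall_rat_scaling {a b s t d : ℝ} (ha : 0 ≤ a) (hb : 0 ≤ b)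
    (h : ∀ q : ℚ, 0 < q → d ≤ max (q * a) ((q : ℝ)⁻¹ * b) * (q * s + (q : ℝ)⁻¹ * t)) :
    d ≤ a * t + b * s := by
  have hr : ∀ r : ℝ, 0 < r → d ≤ max (r * a) (r⁻¹ * b) * (r * s + r⁻¹ * t) := by
    intro r hr
    obtain ⟨q, hqgt, hq⟩ := Real.exists_seq_rat_strictAnti_tendsto r
    have hqs := hq.2
    have hpos : ∀ n, (0 : ℝ) < q n := fun n => hr.trans (hq.1 n)
    have hi := hqs.inv₀ hr.ne'
    exact ge_of_tendsto' (((hqs.mul_const a).max (hi.mul_const b)).mul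
      ((hqs.mul_const s).add (hi.mul_const t))) fun n => h (q n) (by exact_mod_cast hpos n)
  -- If `a = 0` or `b = 0` the optimal scale degenerates, and the bound is reached as `r → ∞` or `r
  -- → 0` respectively.
  rcases ha.eq_or_lt with rfl | ha
  · have hlim : Tendsto (fun r : ℝ => b * s + b * t * (r⁻¹ * r⁻¹)) atTop (𝓝 (b * s)) := by
      have := (tendsto_inv_atTop_zero (𝕜 := ℝ)).mul (tendsto_inv_atTop_zero (𝕜 := ℝ))
      simpa using (this.const_mul (b * t)).const_add (b * s)
    have : d ≤ b * s := by
      refine ge_of_tendsto hlim ?_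
      filter_upwards [eventually_gt_atTop 0] with r hr0
      have h1 := hr r hr0
      rw [mul_zero, max_eq_right (by positivity)] at h1
      refine h1.trans (le_of_eq ?_)
      field_simp
    linarith
  rcases hb.eq_or_lt with rfl | hb
  · have hlim : Tendsto (fun r : ℝ => a * t + a * s * (r⁻¹ * r⁻¹)) atTop (𝓝 (a * t)) := by
      have := (tendsto_inv_atTop_zero (𝕜 := ℝ)).mul (tendsto_inv_atTop_zero (𝕜 := ℝ))
      simpa using (this.const_mul (a * s)).const_add (a * t)
    have : d ≤ a * t := by
      refine ge_of_tendsto hlim ?_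
      filter_upwards [eventually_gt_atTop 0] with r hr0
      have h1 := hr r⁻¹ (inv_pos.2 hr0)
      rw [mul_zero, max_eq_left (by positivity)] at h1
      refine h1.trans (le_of_eq ?_)
      field_simp
      ring
    linarith
  -- This scale equalizes the two entries of the maximum.
  · set r := Real.sqrt (b / a) with hrdef
    have hr0 : 0 < r := Real.sqrt_pos.2 (by positivity)
    have hb' : b = r * r * a := by
      rw [Real.mul_self_sqrt (by positivity)]; field_simp
    have h1 := hr r hr0
    rw [hb', show r⁻¹ * (r * r * a) = r * a by field_simp, max_self] at h1
    rw [hb']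
    refine h1.trans (le_of_eq ?_)
    field_simp
    ring

lemma abs_add_div_two_add_abs_sub_div_two (a b : ℝ) :
    |a + b| / 2 + |a - b| / 2 = max |a| |b| := by
  rcases abs_cases (a + b) with h1 | h1 <;> rcases abs_cases (a - b) with h2 | h2 <;>
  rcases abs_cases a with h3 | h3 <;> rcases abs_cases b with h4 | h4 <;>
  rcases max_cases |a| |b| with h5 | h5 <;> linarith

/-- The square is not globally Lipschitz; this truncation replaces it and changes nothing on the
range of a function bounded by `M`. -/
lemma lipschitzWith_min_abs_sq (M : ℝ≥0) :
    LipschitzWith (2 * M) (fun t : ℝ => (min |t| M) ^ 2) := by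
  refine LipschitzWith.of_dist_le_mul fun x y => ?_
  have h1 : LipschitzWith 1 (fun t : ℝ => min |t| (M : ℝ)) := by
    have : LipschitzWith 1 (fun t : ℝ => |t|) := lipschitzWith_one_norm
    simpa using this.min_const (M : ℝ)
  have h2 := h1.dist_le_mul x y
  rw [NNReal.coe_one, one_mul, Real.dist_eq] at h2
  rw [Real.dist_eq, sq_sub_sq, abs_mul]
  have h3 : |min |x| (M : ℝ) + min |y| (M : ℝ)| ≤ 2 * M := by
    rw [abs_of_nonneg (by positivity)]
    linarith [min_le_right |x| (M : ℝ), min_le_right |y| (M : ℝ)]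
  push_cast
  gcongr

lemma deriv_min_abs_sq {M : ℝ≥0} {t : ℝ} (ht : |t| < M) :
    deriv (fun t : ℝ => (min |t| M) ^ 2) t = 2 * t := by
  have h : (fun t : ℝ => (min |t| (M : ℝ)) ^ 2) =ᶠ[𝓝 t] fun t => t ^ 2 := by
    filter_upwards [(isOpen_lt continuous_abs continuous_const).mem_nhds ht] with r hr
    have hr' : |r| < M := hr
    rw [min_eq_left hr'.le, sq_abs]
  rw [h.deriv_eq]
  simp

end RealInequalities

lemma exists_forall_ae_abs_lt {X : Type*} [MeasurableSpace X] {m : Measure X} {u : X → ℝ}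
    (hu : MemLp u ∞ m) : ∃ M : ℝ≥0, ∀ᵐ x ∂m, |u x| < M := by
  set C : ℝ≥0 := (eLpNorm u ∞ m).toNNReal
  have hC : (C : ℝ≥0∞) = eLpNorm u ∞ m := ENNReal.coe_toNNReal hu.2.ne
  -- The strict inequality makes the truncated square coincide with the square near `u x`, so that
  -- the derivatives agree too.
  refine ⟨C + 1, ?_⟩
  have h := ae_le_eLpNormEssSup (f := u) (μ := m)
  rw [← eLpNorm_exponent_top, ← hC] at h
  filter_upwards [h] with x hx
  rw [enorm_le_coe, ← NNReal.coe_le_coe] at hx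
  rw [coe_nnnorm, Real.norm_eq_abs] at hx
  push_cast
  linarith

/-! ### The Leibniz rule by polarization and optimization of the scale. -/

namespace DStructure

section Leibniz

variable {X : Type*} [MetricSpace X] [MeasurableSpace X] {m : Measure X} {p : ℝ}
  {D : DStructure m p}

lemma mem_pseudoGrad_sq (hball : ∀ (x : X) (r : ℝ), m (Metric.ball x r) < ∞)
    (hp : 1 < p) (hD : D.PointwiseLocal) {u : X → ℝ} (hu : D.MemSobolev u)
    {M : ℝ≥0} (hM : ∀ᵐ x ∂m, |u x| < M) :
    MemLpLoc m p (fun x => u x ^ 2) ∧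
      (fun x => ‖2 * u x‖ₑ * D.minGrad u x) ∈ D.pseudoGrad fun x => u x ^ 2 := by
  have hφ := lipschitzWith_min_abs_sq M
  have hw := hu.lipschitz_comp hball hp hφ
  have he : (fun t : ℝ => (min |t| (M : ℝ)) ^ 2) ∘ u =ᵐ[m] fun x => u x ^ 2 := by
    filter_upwards [hM] with x hx
    simp only [Function.comp]
    rw [min_eq_left hx.le, sq_abs]
  refine ⟨hw.1.congr he, D.congr_ae _ _ _ _ hw.1 he ?_ (D.minGrad_mem hp hw)⟩
  filter_upwards [minGrad_comp_ae_eq hball hp hD hu hφ EventuallyEq.rfl, hM] with x hx hxM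
  rw [hx, deriv_min_abs_sq hxM]

/-- The polarized product estimate, with scaling parameter `r`. -/
lemma mem_pseudoGrad_mul_scaling (hball : ∀ (x : X) (r : ℝ), m (Metric.ball x r) < ∞)
    (hp : 1 < p) (hD : D.PointwiseLocal) {u v : X → ℝ} (hu : D.MemSobolev u)
    (hv : D.MemSobolev v) {M M' : ℝ≥0} (hM : ∀ᵐ x ∂m, |u x| < M) (hM' : ∀ᵐ x ∂m, |v x| < M')
    {r : ℝ} (hr : 0 < r) :
    MemLpLoc m p (fun x => u x * v x) ∧
      (fun x => ENNReal.ofReal (max (r * |u x|) (r⁻¹ * |v x|)) *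
        (ENNReal.ofReal r * D.minGrad u x + ENNReal.ofReal r⁻¹ * D.minGrad v x)) ∈
        D.pseudoGrad fun x => u x * v x := by
  have hri : 0 < r⁻¹ := inv_pos.2 hr
  have hru := hu.const_mul hp r
  have hrv := hv.const_mul hp r⁻¹
  have hrv' := hv.const_mul hp (-r⁻¹)
  have hα := hru.add hp hrv
  have hβ := hru.add hp hrv'
  set K : ℝ≥0 := ⟨r, hr.le⟩ * M + ⟨r⁻¹, hri.le⟩ * M' with hK
  have hbα : ∀ᵐ x ∂m, |r * u x + r⁻¹ * v x| < K := by
    filter_upwards [hM, hM'] with x h1 h2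
    refine (abs_add_le _ _).trans_lt ?_
    rw [abs_mul, abs_mul, abs_of_pos hr, abs_of_pos hri]
    exact add_lt_add (mul_lt_mul_of_pos_left h1 hr) (mul_lt_mul_of_pos_left h2 hri)
  have hbβ : ∀ᵐ x ∂m, |r * u x + -r⁻¹ * v x| < K := by
    filter_upwards [hM, hM'] with x h1 h2
    refine (abs_add_le _ _).trans_lt ?_
    rw [abs_mul, abs_mul, abs_neg, abs_of_pos hr, abs_of_pos hri]
    exact add_lt_add (mul_lt_mul_of_pos_left h1 hr) (mul_lt_mul_of_pos_left h2 hri)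
  obtain ⟨hα1, hα2⟩ := mem_pseudoGrad_sq hball hp hD hα hbα
  obtain ⟨hβ1, hβ2⟩ := mem_pseudoGrad_sq hball hp hD hβ hbβ
  have e : (fun x => (1 / 4 : ℝ) * (r * u x + r⁻¹ * v x) ^ 2 +
      (-(1 / 4 : ℝ)) * (r * u x + -r⁻¹ * v x) ^ 2) = fun x => u x * v x := by
    funext x
    field_simp
    ring
  have hm : AEMeasurable (fun x => ENNReal.ofReal (max (r * |u x|) (r⁻¹ * |v x|)) *
      (ENNReal.ofReal r * D.minGrad u x + ENNReal.ofReal r⁻¹ * D.minGrad v x)) m := by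
    have h1 := hu.1.1.aemeasurable
    have h2 := hv.1.1.aemeasurable
    have h3 := D.aemeasurable_minGrad hp hu
    have h4 := D.aemeasurable_minGrad hp hv
    exact ((((h1.abs).const_mul r).max ((h2.abs).const_mul r⁻¹)).ennreal_ofReal).mul
      ((h3.const_mul _).add (h4.const_mul _))
  have hmem := D.upper_linearity _ _ _ _ _ (1 / 4) (-(1 / 4)) hα1 hβ1 hα2 hβ2 hm (by
    filter_upwards [minGrad_add_le hp hD.2 hru hrv, minGrad_add_le hp hD.2 hru hrv',
      minGrad_const_mul_le hp hD.2 hu r, minGrad_const_mul_le hp hD.2 hv r⁻¹,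
      minGrad_const_mul_le hp hD.2 hv (-r⁻¹)] with x h1 h2 h3 h4 h5
    rw [enorm_neg] at h5
    rw [Real.enorm_eq_ofReal hr.le] at h3
    rw [Real.enorm_eq_ofReal hri.le] at h4 h5
    have h6 := h1.trans (add_le_add h3 h4)
    have h7 := h2.trans (add_le_add h3 h5)
    rw [enorm_neg, ← mul_assoc, ← mul_assoc, ← enorm_mul, ← enorm_mul]
    refine (add_le_add (mul_le_mul_right h6 _) (mul_le_mul_right h7 _)).trans ?_
    rw [← add_mul]
    refine mul_le_mul_left (le_of_eq ?_) _
    rw [Real.enorm_eq_ofReal_abs, Real.enorm_eq_ofReal_abs,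
      ← ENNReal.ofReal_add (abs_nonneg _) (abs_nonneg _)]
    congr 1
    -- Both squared functions have minimal pseudo-gradient at most `r Du + r⁻¹ Dv`; the two weights
    -- are half of `|r u ± r⁻¹ v|` and sum to the maximum.
    have h8 := abs_add_div_two_add_abs_sub_div_two (r * u x) (r⁻¹ * v x)
    rw [abs_mul r, abs_mul r⁻¹, abs_of_pos hr, abs_of_pos hri] at h8
    rw [← h8, ← mul_assoc, ← mul_assoc, abs_mul, abs_mul (1 / 4 * 2),
      show r * u x + -r⁻¹ * v x = r * u x - r⁻¹ * v x by ring,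
      abs_of_pos (show (0 : ℝ) < 1 / 4 * 2 by norm_num)]
    ring)
  have hloc := (hα1.const_mul (1 / 4)).add (hβ1.const_mul (-(1 / 4)))
  rw [e] at hmem hloc
  exact ⟨hloc, hmem⟩

/-- The Leibniz rule for the minimal pseudo-gradient. -/
lemma memSobolev_mul_and_minGrad_mul_le (hball : ∀ (x : X) (r : ℝ), m (Metric.ball x r) < ∞)
    (hp : 1 < p) (hD : D.PointwiseLocal) {u v : X → ℝ} (hu : D.MemSobolev u)
    (hu' : MemLp u ∞ m) (hv : D.MemSobolev v) (hv' : MemLp v ∞ m) :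
    D.MemSobolev (fun x => u x * v x) ∧
      D.minGrad (fun x => u x * v x) ≤ᵐ[m]
        fun x => ‖u x‖ₑ * D.minGrad v x + ‖v x‖ₑ * D.minGrad u x := by
  obtain ⟨M, hM⟩ := exists_forall_ae_abs_lt hu'
  obtain ⟨M', hM'⟩ := exists_forall_ae_abs_lt hv'
  have hsc := fun (r : ℝ) (hr : 0 < r) =>
    mem_pseudoGrad_mul_scaling hball hp hD hu hv hM hM' hr
  have huv : D.MemSobolev (fun x => u x * v x) := by
    -- The scale `1` already has finite energy, by the bounds on `u` and `v`.
    refine D.memSobolev_of_mem (hsc 1 one_pos).1 (hsc 1 one_pos).2 ?_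
    refine lintegral_rpow_lt_top_of_ae_le_mul (C := max M M')
      (h := fun x => D.minGrad u x + D.minGrad v x) (by linarith) ?_
      (ENNReal.lintegral_rpow_add_lt_top_of_lintegral_rpow_lt_top (D.aemeasurable_minGrad hp hu)
        (D.lintegral_minGrad_lt_top hp hu) (D.lintegral_minGrad_lt_top hp hv) hp.le)
    filter_upwards [hM, hM'] with x h1 h2
    simp only [inv_one, one_mul, ENNReal.ofReal_one]
    refine mul_le_mul_left ?_ _
    rw [← ENNReal.ofReal_coe_nnreal]
    refine ENNReal.ofReal_le_ofReal ?_
    rw [NNReal.coe_max]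
    exact max_le_max h1.le h2.le
  refine ⟨huv, ?_⟩
  -- The optimal scale depends on the point, so a single null set is needed for all scales: only
  -- rational ones are used.
  have key : ∀ q : ℚ, ∀ᵐ x ∂m, 0 < q → D.minGrad (fun x => u x * v x) x ≤
      ENNReal.ofReal (max (q * |u x|) ((q : ℝ)⁻¹ * |v x|)) *
        (ENNReal.ofReal q * D.minGrad u x + ENNReal.ofReal (q : ℝ)⁻¹ * D.minGrad v x) := by
    intro q
    by_cases hq : 0 < q
    · filter_upwards [hD.2 _ _ huv (hsc q (by exact_mod_cast hq)).2] with x hx _ using hx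
    · exact ae_of_all _ fun x h => absurd h hq
  filter_upwards [ae_all_iff.2 key, D.minGrad_ne_top hp hu, D.minGrad_ne_top hp hv,
    D.minGrad_ne_top hp huv] with x hx h1 h2 h3
  generalize D.minGrad (fun x => u x * v x) x = d at *
  generalize D.minGrad u x = s at *
  generalize D.minGrad v x = t at *
  lift s to ℝ≥0 using h1
  lift t to ℝ≥0 using h2
  lift d to ℝ≥0 using h3
  have hreal : (d : ℝ) ≤ |u x| * t + |v x| * s := by
    refine le_add_of_forall_rat_scaling (abs_nonneg _) (abs_nonneg _) fun q hq => ?_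
    have hq' : (0 : ℝ) < q := by exact_mod_cast hq
    have hqi : (0 : ℝ) < (q : ℝ)⁻¹ := inv_pos.2 hq'
    have h := hx q hq
    rw [← ENNReal.ofReal_coe_nnreal, ← ENNReal.ofReal_coe_nnreal, ← ENNReal.ofReal_coe_nnreal,
      ← ENNReal.ofReal_mul hq'.le, ← ENNReal.ofReal_mul hqi.le,
      ← ENNReal.ofReal_add (by positivity) (by positivity),
      ← ENNReal.ofReal_mul (by positivity)] at h
    exact (ENNReal.ofReal_le_ofReal_iff (by positivity)).1 h
  rw [Real.enorm_eq_ofReal_abs, Real.enorm_eq_ofReal_abs, ← ENNReal.ofReal_coe_nnreal,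
    ← ENNReal.ofReal_coe_nnreal, ← ENNReal.ofReal_coe_nnreal,
    ← ENNReal.ofReal_mul (abs_nonneg _), ← ENNReal.ofReal_mul (abs_nonneg _),
    ← ENNReal.ofReal_add (by positivity) (by positivity)]
  exact ENNReal.ofReal_le_ofReal hreal

end Leibniz

end DStructure

/-! ### Assembly of the calculus rules. -/

theorem proposition2p9 {X : Type*} [MetricSpace X] [CompleteSpace X]
    [TopologicalSpace.SeparableSpace X] [MeasurableSpace X] [BorelSpace X]
    (m : Measure X) (hm : m ≠ 0) (hball : ∀ (x : X) (r : ℝ), m (Metric.ball x r) < ∞)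
    (p : ℝ) (hp : 1 < p) (D : DStructure m p) (hD : D.PointwiseLocal) :
    -- the minimal pseudo-gradient is well defined
    (∀ u : X → ℝ, D.MemSobolev u →
      D.IsMinimal u (D.minGrad u) ∧
      ∀ g : X → ℝ≥0∞, D.IsMinimal u g → g =ᵐ[m] D.minGrad u) ∧
    -- vanishing on preimages of null sets
    (∀ u : X → ℝ, D.MemSobolev u →
      ∀ N : Set ℝ, MeasurableSet N → volume N = 0 →
        ∀ᵐ x ∂m, x ∈ u ⁻¹' N → D.minGrad u x = 0) ∧
    -- chain rule; `φ'` is any function that agrees Lebesgue-a.e. with the derivative of `φ`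
    (∀ u : X → ℝ, D.MemSobolev u →
      ∀ φ : ℝ → ℝ, (∃ K, LipschitzWith K φ) →
        ∀ φ' : ℝ → ℝ, φ' =ᵐ[volume] deriv φ →
          (fun x => ‖φ' (u x)‖ₑ * D.minGrad u x) ∈ D.pseudoGrad (φ ∘ u) ∧
          D.MemSobolev (φ ∘ u) ∧
          D.minGrad (φ ∘ u) =ᵐ[m] fun x => ‖φ' (u x)‖ₑ * D.minGrad u x) ∧
    -- Leibniz rule
    (∀ u v : X → ℝ, D.MemSobolev u → MemLp u ∞ m → D.MemSobolev v → MemLp v ∞ m →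
      (fun x => ‖u x‖ₑ * D.minGrad v x + ‖v x‖ₑ * D.minGrad u x) ∈
        D.pseudoGrad (fun x => u x * v x) ∧
      D.MemSobolev (fun x => u x * v x) ∧
      MemLp (fun x => u x * v x) ∞ m ∧
      D.minGrad (fun x => u x * v x) ≤ᵐ[m]
        fun x => ‖u x‖ₑ * D.minGrad v x + ‖v x‖ₑ * D.minGrad u x) := by
  refine ⟨fun u hu => ⟨D.isMinimal_minGrad hp hu, fun g hg => hg.ae_eq_minGrad hp hD.2 hu⟩,
    fun u hu N hN hN0 => DStructure.minGrad_eq_zero_of_null hball hp hD hu hN hN0,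
    fun u hu φ ⟨L, hφ⟩ φ' hφ' => ?_, fun u v hu hu' hv hv' => ?_⟩
  · have hw := hu.lipschitz_comp hball hp hφ
    have he := DStructure.minGrad_comp_ae_eq hball hp hD hu hφ hφ'
    exact ⟨D.congr_ae _ _ _ _ hw.1 EventuallyEq.rfl he (D.minGrad_mem hp hw), hw, he⟩
  · obtain ⟨hw, hle⟩ := DStructure.memSobolev_mul_and_minGrad_mul_le hball hp hD hu hu' hv hv'
    -- Membership follows from the pointwise bound, since any measurable function above a
    -- pseudo-gradient is one.
    refine ⟨D.mem_of_le hw.1 (D.minGrad_mem hp hw) ?_ hle, hw, hv'.mul hu', hle⟩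
    exact (hu.1.1.enorm.mul (D.aemeasurable_minGrad hp hv)).add
      (hv.1.1.enorm.mul (D.aemeasurable_minGrad hp hu))
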